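/- Let $\mathbb A$ be an infinite set (of names) and $\operatorname{Perm}(\mathbb A)$ its group of finite permutations. A finite set $S\subseteq\mathbb A$ supports an element $x$ of a $\operatorname{Perm}(\mathbb A)$-set if every $\pi\in\operatorname{Perm}(\mathbb A)$ that fixes each element of $S$ satisfies $\pi x=x$; a nominal set is a $\operatorname{Perm}(\mathbb A)$-set all of whose elements have a finite support; $x\mathrel{\#}y$ means that $x$ and $y$ have disjoint finite supports. A $01$-substitution set is a nominal set $X$ with an equivariant map $X\times\mathbb A\times\{0,1\}\to X$, $(x,a,i)\mapsto x(a:=i)$, such that (i) $a\mathrel{\#}x(a:=i)$; (ii) $x(a:=i)=x$ if $a\mathrel{\#}x$; (iii) $x(a:=i)(a':=i')=x(a':=i')(a:=i)$ if $a\ne a'$. With the equivariant maps that preserve substitution as morphisms these form the category $\mathsf{01Sub}$. Let $f:X\to Y$ be a morphism in $\mathsf{01Sub}$ and $\varepsilon\in\{0,1\}$. **Kan fibrations.** For $A\subseteq\mathbb A$ finite and $a\in A$, an $\varepsilon$-open $(A,a)$-box over $f$ is a pair $(u,y)$ with $y\in Y$ and $u:(A\times\{0,1\})\setminus\{(a,\varepsilon)\}\to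 X$ such that, for all $(b,i),(b',i')$ in the domain of $u$: $b\mathrel{\#}u(b,i)$; $u(b,i)(b':=i')=u(b',i')(b:=i)$ if $b\neq b'$; and $f(u(b,i))=y(b:=i)$. A filler of $(u,y)$ is an $x\in X$ with $f(x)=y$ and $x(b:=i)=u(b,i)$ for all $(b,i)$ in the domain of $u$. Permutations act on open boxes by $(\pi u)(\pi b,i)=\pi(u(b,i))$ (so $\pi(u,y)=(\pi u,\pi y)$ is an open $(\pi A,\pi a)$-box), and for $c\notin A$ the box $(u,y)(c:=i)$ is formed componentwise. A Kan filling operator for $\varepsilon$-open boxes over $f$ is a choice of a filler $F(u,y)$ for every $\varepsilon$-open $(A,a)$-box $(u,y)$ (for all $A$ and $a$) such that $F(\pi(u,y))=\pi F(u,y)$ for all $\pi\in\operatorname{Perm}(\mathbb A)$, and $F((u,y)(c:=i))=F(u,y)(c:=i)$ for all $c\notin A$ and $i\in\{0,1\}$. The map $f$ is a Kan fibration if it has Kan filling operators both for $1$-open and for $0$-open boxes. **The monad $R$.** Write $\langle a\rangle z$ for the class of $(a,z)$ under $\alpha$-equivalence, where $(a,z)\sim(a',z')$ iff $(c\;a)z=(c\;a')z'$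 for some name $c$ fresh for $a,z,a',z'$. Let $K_0f=X$ and $\rho_0=f$. Given $\rho_n:K_nf\to Y$, let the nominal set $K_{n+1}f$ be the disjoint union of $X$ and, for each $\varepsilon\in\{0,1\}$, of the set of $\varepsilon$-open boxes $(u,y)$ over $\rho_n$ and of the set of the elements $\langle a\rangle(u,y)$ with $(u,y)$ an $\varepsilon$-open $(A,a)$-box over $\rho_n$ for some $A\ni a$. The inclusion $K_nf\to K_{n+1}f$ is the inclusion of $X$ for $n=0$ and is induced componentwise by $K_{n-1}f\to K_nf$ for $n>0$. Substitution in $K_{n+1}f$ is that of $X$ on $X$; on boxes, $(u,y)(c:=i)$ is $u(c,i)$ if $(c,i)$ is in the domain of $u$, it is $\langle a\rangle(u,y)$ if $(c,i)=(a,\varepsilon)$, and it is the componentwise substitution if $c\notin A$; and, choosing a representative with $a\neq c$, $(\langle a\rangle(u,y))(c:=i)$ is $u(c,i)(a:=\varepsilon)$ if $c\in A$ and $\langle a\rangle\big((u,y)(c:=i)\big)$ if $c\notin A$. The map $\rho_{n+1}$ is $f$ on $X$, sends $(u,y)$ to $y$, and sends $\langle a\rangle(u,y)$ to $y(a:=\varepsilon)$.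 Let $Kf=\operatorname{colim}_nK_nf$, with the induced maps $\lambda_f:X\to Kf$ and $\rho_f:Kf\to Y$, $\rho_f\lambda_f=f$. An open box over $\rho_f$ is also an element of $Kf$, and so is $\langle a\rangle(u,y)$ for an open $(A,a)$-box $(u,y)$ over $\rho_f$. For a commutative square $(h,k):f\to g$ the map $K(h,k):Kf\to Kg$ is $h$ on $X$ and is given recursively by $(u,y)\mapsto(K(h,k)\circ u,k(y))$ and $\langle a\rangle(u,y)\mapsto\langle a\rangle(K(h,k)\circ u,k(y))$. The map $\pi_f:K\rho_f\to Kf$ is the identity on $Kf$ and is given recursively by $(u,y)\mapsto(\pi_f\circ u,y)$ and $\langle a\rangle(u,y)\mapsto\langle a\rangle(\pi_f\circ u,y)$. On the arrow category of $\mathsf{01Sub}$ let $R$ be the monad with $Rf=\rho_f$, $R(h,k)=(K(h,k),k)$, unit $(\lambda_f,1_Y):f\to\rho_f$ and multiplication $(\pi_f,1_Y):\rho_{\rho_f}\to\rho_f$. A pointed-endofunctor $R$-algebra structure on $f$ is a morphism $Rf\to f$ in the arrow category that satisfies the unit law; a monad $R$-algebra structure on $f$ is one that satisfies the multiplication law as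 well. Let $\overline{\mathcal R}$ be the class of all retracts, in the arrow category, of morphisms of $\mathsf{01Sub}$ that admit a monad $R$-algebra structure. **Theorem.** For every morphism $f:X\to Y$ in $\mathsf{01Sub}$ the following are equivalent: 1. $f\in\overline{\mathcal R}$; 2. $f$ admits a pointed-endofunctor $R$-algebra structure; 3. $f$ is a Kan fibration; 4. $f$ admits a monad $R$-algebra structure. -/

import Mathlib

open CategoryTheory
open scoped Classical

universe u

namespace ZeroOne

noncomputable section

set_option linter.unusedSectionVars false

/-! ### Names, finite permutations and nominal sets -/

/-- The group of finite permutations of the set of names `𝔸`. -/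
def FinPerm (𝔸 : Type u) : Subgroup (Equiv.Perm 𝔸) where
  carrier := {π | {a | π a ≠ a}.Finite}
  one_mem' := by simp
  mul_mem' := by
    intro π σ hπ hσ
    refine (hπ.union hσ).subset ?_
    intro a ha
    by_contra h
    simp only [Set.mem_union, Set.mem_ofPred_eq, not_or, not_not] at h
    exact ha (by simp [h.1, h.2])
  inv_mem' := by
    intro π hπ
    refine hπ.subset ?_
    intro a ha h
    exact ha (by rw [Equiv.Perm.inv_eq_iff_eq]; exact h.symm)

variable {𝔸 : Type u}

/-- The transposition `(a b)`. -/
def transp (a b : 𝔸) : FinPerm 𝔸 :=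
  ⟨Equiv.swap a b, by
    refine (Set.toFinite {a, b}).subset ?_
    intro c hc
    by_contra h
    simp only [Set.mem_insert_iff, Set.mem_singleton_iff, not_or] at h
    exact hc (Equiv.swap_apply_of_ne_of_ne h.1 h.2)⟩

/-- A nominal set: an action of the finite permutations such that every element has a finite
support. -/
class NominalSet (𝔸 : Type u) (X : Type u) extends MulAction (FinPerm 𝔸) X where
  exists_support : ∀ x : X, ∃ S : Finset 𝔸, MulAction.Supports (FinPerm 𝔸) (S : Set 𝔸) x

/-- `x # y`: the elements `x` and `y` have disjoint finite supports. -/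
def Fresh (𝔸 : Type u) {X Y : Type u} [MulAction (FinPerm 𝔸) X] [MulAction (FinPerm 𝔸) Y]
    (x : X) (y : Y) : Prop :=
  ∃ S T : Finset 𝔸, MulAction.Supports (FinPerm 𝔸) (S : Set 𝔸) x ∧
    MulAction.Supports (FinPerm 𝔸) (T : Set 𝔸) y ∧ Disjoint S T

/-- `α`-equivalence of pairs `(a, x)`; the class of `(a, x)` is the name abstraction `⟨a⟩x`. -/
def AlphaEquiv (𝔸 : Type u) {X : Type u} [NominalSet 𝔸 X] (p q : 𝔸 × X) : Prop :=
  ∃ c : 𝔸, Fresh 𝔸 c p.1 ∧ Fresh 𝔸 c p.2 ∧ Fresh 𝔸 c q.1 ∧ Fresh 𝔸 c q.2 ∧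
    transp c p.1 • p.2 = transp c q.1 • q.2

section lemmas

@[simp] theorem transp_left (a b : 𝔸) : transp a b • a = b := Equiv.swap_apply_left a b

@[simp] theorem transp_right (a b : 𝔸) : transp a b • b = a := Equiv.swap_apply_right a b

theorem transp_of_ne {a b c : 𝔸} (h : c ≠ a) (h' : c ≠ b) : transp a b • c = c :=
  Equiv.swap_apply_of_ne_of_ne h h'

theorem transp_comm (a b : 𝔸) : transp a b = transp b a := Subtype.ext (Equiv.swap_comm a b)

theorem transp_conj (π : FinPerm 𝔸) (a b : 𝔸) :
    π * transp a b = transp (π • a) (π • b) * π := by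
  apply Subtype.ext
  ext c
  exact Equiv.ext_iff.1 (Equiv.mul_swap_eq_swap_mul π.1 a b) c

theorem smul_transp_smul {X : Type u} [MulAction (FinPerm 𝔸) X] (π : FinPerm 𝔸) (a b : 𝔸)
    (x : X) : π • transp a b • x = transp (π • a) (π • b) • π • x := by
  rw [← mul_smul, transp_conj, mul_smul]

@[simp] theorem transp_transp {X : Type u} [MulAction (FinPerm 𝔸) X] (a b : 𝔸)
    (x : X) : transp a b • transp a b • x = x := by
  rw [← mul_smul]
  have : transp a b * transp a b = 1 := Subtype.ext (Equiv.swap_mul_self a b)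
  rw [this, one_smul]

theorem Fresh.smul {X Y : Type u} [MulAction (FinPerm 𝔸) X] [MulAction (FinPerm 𝔸) Y]
    {a : X} {x : Y} (h : Fresh 𝔸 a x) (π : FinPerm 𝔸) :
    Fresh 𝔸 (π • a) (π • x) := by
  have key : ∀ {Z : Type u} [MulAction (FinPerm 𝔸) Z] (S : Finset 𝔸) (z : Z),
      MulAction.Supports (FinPerm 𝔸) (S : Set 𝔸) z →
      MulAction.Supports (FinPerm 𝔸) ((S.map π.1.toEmbedding : Finset 𝔸) : Set 𝔸) (π • z) := by
    intro Z _ S z hS σ hσ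
    have := hS (π⁻¹ * σ * π) (by
      intro c hc
      have h1 : σ • π • c = π • c := hσ (by
        simp only [Finset.coe_map, Set.mem_image]; exact ⟨c, hc, rfl⟩)
      rw [mul_smul, mul_smul, h1, inv_smul_smul])
    rw [mul_smul, mul_smul, inv_smul_eq_iff] at this
    exact this
  obtain ⟨S, T, hS, hT, hd⟩ := h
  exact ⟨_, _, key S a hS, key T x hT, by simpa using hd⟩

variable [Infinite 𝔸] {X Y : Type u} [NominalSet 𝔸 X] [NominalSet 𝔸 Y]

theorem exists_notMem (S : Finset 𝔸) : ∃ a, a ∉ S := Infinite.exists_notMem_finset S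

theorem fresh_iff {a : 𝔸} {x : X} :
    Fresh 𝔸 a x ↔ ∃ T : Finset 𝔸, a ∉ T ∧ MulAction.Supports (FinPerm 𝔸) (T : Set 𝔸) x := by
  constructor
  · rintro ⟨S, T, hS, hT, hd⟩
    refine ⟨T, fun haT => ?_, hT⟩
    have haS : a ∉ S := fun h => Finset.disjoint_left.1 hd h haT
    obtain ⟨b, hb⟩ := exists_notMem (insert a S)
    simp only [Finset.mem_insert, not_or] at hb
    have := hS (transp a b) (fun c hc =>
      transp_of_ne (fun h => haS (h ▸ hc)) (fun h => hb.2 (h ▸ hc)))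
    rw [transp_left] at this
    exact hb.1 this
  · rintro ⟨T, haT, hT⟩
    exact ⟨{a}, T, fun π h => h (by simp), hT, by simpa using haT⟩

theorem fresh_name {a b : 𝔸} : Fresh 𝔸 a b ↔ a ≠ b := by
  constructor
  · rintro ⟨S, T, hS, hT, hd⟩ rfl
    obtain ⟨b, hb⟩ := exists_notMem (insert a (S ∪ T))
    simp only [Finset.mem_insert, Finset.mem_union, not_or] at hb
    by_cases haS : a ∈ S
    · have haT := Finset.disjoint_left.1 hd haS
      have := hT (transp a b) (fun c hc =>
        transp_of_ne (fun h => haT (h ▸ hc)) (fun h => hb.2.2 (h ▸ hc)))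
      rw [transp_left] at this
      exact hb.1 this
    · have := hS (transp a b) (fun c hc =>
        transp_of_ne (fun h => haS (h ▸ hc)) (fun h => hb.2.1 (h ▸ hc)))
      rw [transp_left] at this
      exact hb.1 this
  · intro h
    exact ⟨{a}, {b}, fun π h => h (by simp), fun π h => h (by simp), by simpa using h⟩

variable (𝔸) in
/-- Some finite support of `x`. -/
def someSupp (x : X) : Finset 𝔸 := (NominalSet.exists_support x).choose

theorem someSupp_supports (x : X) :
    MulAction.Supports (FinPerm 𝔸) (someSupp 𝔸 x : Set 𝔸) x :=
  (NominalSet.exists_support x).choose_spec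

theorem fresh_of_notMem {a : 𝔸} {x : X} (h : a ∉ someSupp 𝔸 x) : Fresh 𝔸 a x :=
  fresh_iff.2 ⟨_, h, someSupp_supports x⟩

theorem exists_fresh (S : Finset 𝔸) (x : X) : ∃ a : 𝔸, a ∉ S ∧ Fresh 𝔸 a x := by
  obtain ⟨a, ha⟩ := exists_notMem (S ∪ someSupp 𝔸 x)
  simp only [Finset.mem_union, not_or] at ha
  exact ⟨a, ha.1, fresh_of_notMem ha.2⟩

theorem transp_fresh {a b : 𝔸} {x : X} (ha : Fresh 𝔸 a x) (hb : Fresh 𝔸 b x) :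
    transp a b • x = x := by
  obtain ⟨S, haS, hS⟩ := fresh_iff.1 ha
  obtain ⟨T, hbT, hT⟩ := fresh_iff.1 hb
  obtain ⟨d, hd⟩ := exists_notMem (insert a (insert b (S ∪ T)))
  simp only [Finset.mem_insert, Finset.mem_union, not_or] at hd
  by_cases hab : a = b
  · subst hab
    have : transp a a = 1 := Subtype.ext (Equiv.swap_self a)
    rw [this, one_smul]
  have h1 : transp a d • x = x := hS _ (fun c hc =>
    transp_of_ne (fun h => haS (h ▸ hc)) (fun h => hd.2.2.1 (h ▸ hc)))
  have h2 : transp b d • x = x := hT _ (fun c hc =>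
    transp_of_ne (fun h => hbT (h ▸ hc)) (fun h => hd.2.2.2 (h ▸ hc)))
  have h3 := smul_transp_smul (transp a d) b d x
  rw [h2, h1, transp_of_ne (Ne.symm hab) (Ne.symm hd.2.1), transp_right, transp_comm] at h3
  exact h3.symm

end lemmas

/-! ### 01-substitution sets -/

/-- A 01-substitution set: a nominal set with an equivariant operation `x ↦ x(a := i)`, where
`false` stands for `0` and `true` for `1`. -/
class ZeroOneSet (𝔸 : Type u) (X : Type u) extends NominalSet 𝔸 X where
  sub : X → 𝔸 → Bool → X
  smul_sub : ∀ (π : FinPerm 𝔸) x a i, π • sub x a i = sub (π • x) (π • a) i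
  fresh_sub : ∀ x a i, Fresh 𝔸 a (sub x a i)
  sub_of_fresh : ∀ x a i, Fresh 𝔸 a x → sub x a i = x
  sub_comm : ∀ x a i a' i', a ≠ a' → sub (sub x a i) a' i' = sub (sub x a' i') a i

open ZeroOneSet (sub)

/-- The objects of the category of 01-substitution sets. -/
structure Sub01 (𝔸 : Type u) where
  carrier : Type u
  [str : ZeroOneSet 𝔸 carrier]

attribute [instance] Sub01.str

instance : CoeSort (Sub01 𝔸) (Type u) := ⟨Sub01.carrier⟩

/-- Morphisms of 01-substitution sets: equivariant functions that preserve substitution. -/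
@[ext]
structure Sub01.Hom (X Y : Sub01 𝔸) where
  toFun : X → Y
  map_smul' : ∀ (π : FinPerm 𝔸) x, toFun (π • x) = π • toFun x
  map_sub' : ∀ x (a : 𝔸) i, toFun (sub x a i) = sub (toFun x) a i

instance : Category (Sub01 𝔸) where
  Hom := Sub01.Hom
  id X := ⟨id, fun _ _ => rfl, fun _ _ _ => rfl⟩
  comp f g := ⟨g.toFun ∘ f.toFun, fun π x => by simp [f.map_smul', g.map_smul'],
    fun x a i => by simp [f.map_sub', g.map_sub']⟩

instance {X Y : Sub01 𝔸} : FunLike (X ⟶ Y) X Y where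
  coe f := Sub01.Hom.toFun f
  coe_injective := fun _ _ h => Sub01.Hom.ext h

section homs

variable {X Y Z : Sub01 𝔸}

theorem map_smul (f : X ⟶ Y) (π : FinPerm 𝔸) (x : X) : f (π • x) = π • f x :=
  Sub01.Hom.map_smul' f π x

theorem map_sub (f : X ⟶ Y) (x : X) (a : 𝔸) (i : Bool) : f (sub x a i) = sub (f x) a i :=
  Sub01.Hom.map_sub' f x a i

@[simp] theorem comp_apply (f : X ⟶ Y) (g : Y ⟶ Z) (x : X) : (f ≫ g) x = g (f x) := rfl

@[simp] theorem id_apply (x : X) : (𝟙 X : X ⟶ X) x = x := rfl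

theorem hom_ext {f g : X ⟶ Y} (h : ∀ x, f x = g x) : f = g := DFunLike.ext _ _ h

end homs

section lemmas

variable [Infinite 𝔸] {X Y : Type u}

/-- Equivariant functions preserve supports. -/
theorem Fresh.map [MulAction (FinPerm 𝔸) X] [MulAction (FinPerm 𝔸) Y] {F : X → Y}
    (hF : ∀ (π : FinPerm 𝔸) x, F (π • x) = π • F x)
    {a : 𝔸} {x : X} (h : Fresh 𝔸 a x) : Fresh 𝔸 a (F x) := by
  obtain ⟨S, T, hS, hT, hd⟩ := h
  exact ⟨S, T, hS, fun π hπ => by rw [← hF, hT π hπ], hd⟩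

theorem Fresh.sub_of_ne [ZeroOneSet 𝔸 X] {a c : 𝔸} {x : X} (h : Fresh 𝔸 a x) (hac : a ≠ c)
    (i : Bool) : Fresh 𝔸 a (sub x c i) := by
  obtain ⟨T, haT, hT⟩ := fresh_iff.1 h
  refine fresh_iff.2 ⟨insert c T, by simp [hac, haT], fun π hπ => ?_⟩
  rw [ZeroOneSet.smul_sub, hT π (fun d hd => hπ (by simp [Finset.mem_coe.1 hd])),
    hπ (a := c) (by simp)]

theorem Fresh.sub_any [ZeroOneSet 𝔸 X] {a : 𝔸} {x : X} (h : Fresh 𝔸 a x) (c : 𝔸)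
    (i : Bool) : Fresh 𝔸 a (sub x c i) := by
  by_cases hac : a = c
  · subst hac; exact ZeroOneSet.fresh_sub _ _ _
  · exact h.sub_of_ne hac i

end lemmas

/-! ### Open boxes and Kan fibrations -/

/-- The pairs `(b, i)` in `(A × 2) \ {(a, ε)}`. -/
def Face (A : Finset 𝔸) (a : 𝔸) (ε : Bool) (b : 𝔸) (i : Bool) : Prop :=
  b ∈ A ∧ (b, i) ≠ (a, ε)

/-- The `ε`-open boxes `(u, y)` over `f`, for all `A` and `a`; so `1`-open boxes are
`OpenBox f true` and `0`-open boxes are `OpenBox f false`. -/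
structure OpenBox {X Y : Sub01 𝔸} (f : X ⟶ Y) (ε : Bool) where
  A : Finset 𝔸
  a : 𝔸
  a_mem : a ∈ A
  u : ∀ b i, Face A a ε b i → X
  y : Y
  fresh : ∀ b i h, Fresh 𝔸 b (u b i h)
  adj : ∀ b i h b' i' h', b ≠ b' → sub (u b i h) b' i' = sub (u b' i' h') b i
  proj : ∀ b i h, f (u b i h) = sub y b i

namespace OpenBox

section basic

variable {X Y : Sub01 𝔸} {f : X ⟶ Y} {ε : Bool}

theorem u_congr (b : OpenBox f ε) {c c' : 𝔸} {i : Bool} (hc : c = c') (h : Face b.A b.a ε c i)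
    (h' : Face b.A b.a ε c' i) : b.u c i h = b.u c' i h' := by
  subst hc; rfl

theorem ext' {b b' : OpenBox f ε} (hA : b.A = b'.A) (ha : b.a = b'.a) (hy : b.y = b'.y)
    (hu : ∀ c i h h', b.u c i h = b'.u c i h') : b = b' := by
  rcases b with ⟨A, a, _, u, y, _, _, _⟩
  rcases b' with ⟨A', a', _, u', y', _, _, _⟩
  dsimp only at hA ha hy hu
  subst hA ha hy
  have : u = u' := by
    funext c i h
    exact hu c i h h
  subst this
  rfl

theorem u_eq {b b' : OpenBox f ε} (e : b = b') {c : 𝔸} {i : Bool} (h : Face b.A b.a ε c i)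
    (h' : Face b'.A b'.a ε c i) : b.u c i h = b'.u c i h' := by
  subst e; rfl

theorem face_inv {A : Finset 𝔸} {a : 𝔸} {c : 𝔸} {i : Bool} (π : FinPerm 𝔸)
    (h : Face (A.map π.1.toEmbedding) (π • a) ε c i) : Face A a ε (π⁻¹ • c) i := by
  obtain ⟨h1, h2⟩ := h
  simp only [Finset.mem_map] at h1
  obtain ⟨d, hd, rfl⟩ := h1
  have : π⁻¹ • (π.1.toEmbedding d) = d := inv_smul_smul π d
  rw [this]
  refine ⟨hd, fun h => h2 ?_⟩
  simp only [Prod.mk.injEq] at h ⊢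
  exact ⟨by rw [h.1]; rfl, h.2⟩

/-- Finite permutations act on open boxes by `(π u)(b, i) = π (u (π⁻¹ b, i))`. -/
instance : SMul (FinPerm 𝔸) (OpenBox f ε) where
  smul π b :=
    { A := b.A.map π.1.toEmbedding
      a := π • b.a
      a_mem := Finset.mem_map.2 ⟨b.a, b.a_mem, rfl⟩
      u := fun c i h => π • b.u (π⁻¹ • c) i (face_inv π h)
      y := π • b.y
      fresh := fun c i h => by
        have := (b.fresh _ _ (face_inv π h)).smul π
        rwa [smul_inv_smul] at this
      adj := fun c i h c' i' h' hne => by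
        have := b.adj _ _ (face_inv π h) _ _ (face_inv π h')
          (fun e => hne (smul_left_cancel _ e))
        have := congrArg (π • ·) this
        simpa only [ZeroOneSet.smul_sub, smul_inv_smul] using this
      proj := fun c i h => by
        rw [map_smul, b.proj, ZeroOneSet.smul_sub, smul_inv_smul] }

theorem smul_A (π : FinPerm 𝔸) (b : OpenBox f ε) : (π • b).A = b.A.map π.1.toEmbedding := rfl

@[simp] theorem smul_a (π : FinPerm 𝔸) (b : OpenBox f ε) : (π • b).a = π • b.a := rfl

@[simp] theorem smul_y (π : FinPerm 𝔸) (b : OpenBox f ε) : (π • b).y = π • b.y := rfl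

theorem smul_u (π : FinPerm 𝔸) (b : OpenBox f ε) (c : 𝔸) (i : Bool)
    (h : Face (π • b).A (π • b).a ε c i) :
    (π • b).u c i h = π • b.u (π⁻¹ • c) i (face_inv π h) := rfl

theorem smul_mem_A {π : FinPerm 𝔸} {b : OpenBox f ε} {c : 𝔸} :
    π • c ∈ (π • b).A ↔ c ∈ b.A := Finset.mem_map' π.1.toEmbedding

theorem smul_face {π : FinPerm 𝔸} {b : OpenBox f ε} {c : 𝔸} {i : Bool} :
    Face (π • b).A (π • b).a ε (π • c) i ↔ Face b.A b.a ε c i := by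
  simp only [Face, smul_mem_A, smul_a, ne_eq, Prod.mk.injEq, smul_left_cancel_iff]

theorem smul_u_smul (π : FinPerm 𝔸) (b : OpenBox f ε) (c : 𝔸) (i : Bool)
    (h : Face (π • b).A (π • b).a ε (π • c) i) (h' : Face b.A b.a ε c i) :
    (π • b).u (π • c) i h = π • b.u c i h' := by
  rw [smul_u, b.u_congr (inv_smul_smul π c)]

instance : MulAction (FinPerm 𝔸) (OpenBox f ε) where
  one_smul b := by
    refine ext' ?_ (one_smul _ _) (one_smul _ _) ?_
    · ext c
      rw [smul_A]
      exact ⟨fun h => (by obtain ⟨d, hd, rfl⟩ := Finset.mem_map.1 h; exact hd),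
        fun h => Finset.mem_map.2 ⟨c, h, rfl⟩⟩
    · intro c i h h'
      rw [smul_u, one_smul]
      exact b.u_congr (by simp) _ _
  mul_smul π σ b := by
    refine ext' ?_ (mul_smul _ _ _) (mul_smul _ _ _) ?_
    · ext c
      simp only [smul_A, Finset.mem_map]
      constructor
      · rintro ⟨d, hd, rfl⟩
        exact ⟨_, ⟨d, hd, rfl⟩, rfl⟩
      · rintro ⟨_, ⟨d, hd, rfl⟩, rfl⟩
        exact ⟨d, hd, rfl⟩
    · intro c i h h'
      rw [smul_u, smul_u, smul_u, ← mul_smul]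
      exact congrArg _ (b.u_congr (by rw [mul_inv_rev, mul_smul]) _ _)

instance : NominalSet 𝔸 (OpenBox f ε) where
  exists_support b := by
    choose F hF using fun x : X => NominalSet.exists_support (𝔸 := 𝔸) x
    obtain ⟨T, hT⟩ := NominalSet.exists_support (𝔸 := 𝔸) b.y
    refine ⟨b.A ∪ T ∪ (b.A.biUnion fun c => Finset.univ.biUnion fun i =>
      if h : Face b.A b.a ε c i then F (b.u c i h) else ∅), ?_⟩
    intro π hπ
    have hA : ∀ c ∈ b.A, π • c = c := fun c hc => hπ (by simp [hc])
    have hT' : π • b.y = b.y := hT π (fun d hd => hπ (by simp [Finset.mem_coe.1 hd]))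
    refine ext' ?_ (hA _ b.a_mem) hT' ?_
    · rw [smul_A]
      refine (Finset.map_eq_of_subset ?_)
      intro c hc
      obtain ⟨d, hd, rfl⟩ := Finset.mem_map.1 hc
      have := hA d hd
      change π • d ∈ b.A
      rwa [this]
    · intro c i h h'
      have hc := hA c h'.1
      have hc' : π⁻¹ • c = c := by rw [inv_smul_eq_iff, hc]
      rw [smul_u, b.u_congr hc' _ h']
      refine hF _ π (fun d hd => hπ ?_)
      simp only [Finset.coe_union, Set.mem_union]
      right
      simp only [Finset.mem_coe, Finset.mem_biUnion]
      exact ⟨c, h'.1, i, Finset.mem_univ _, by rwa [dif_pos h']⟩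

variable [Infinite 𝔸]

/-- The substitution `(u, y)(c := j)`, for `c ∉ A`. -/
def sub (b : OpenBox f ε) (c : 𝔸) (j : Bool) (hc : c ∉ b.A) : OpenBox f ε where
  A := b.A
  a := b.a
  a_mem := b.a_mem
  u := fun d i h => ZeroOneSet.sub (b.u d i h) c j
  y := ZeroOneSet.sub b.y c j
  fresh := fun d i h => by
    exact (b.fresh d i h).sub_of_ne (fun e : d = c => hc (e ▸ h.1)) j
  adj := fun d i h d' i' h' hne => by
    have hdc : d ≠ c := fun e => hc (e ▸ h.1)
    have hdc' : d' ≠ c := fun e => hc (e ▸ h'.1)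
    rw [ZeroOneSet.sub_comm _ _ _ _ _ hdc'.symm, b.adj d i h d' i' h' hne,
      ZeroOneSet.sub_comm _ _ _ _ _ hdc]
  proj := fun d i h => by
    have hdc : d ≠ c := fun e => hc (e ▸ h.1)
    rw [map_sub, b.proj, ZeroOneSet.sub_comm _ _ _ _ _ hdc]

theorem fresh_notMem {b : OpenBox f ε} {c : 𝔸} (h : Fresh 𝔸 c b) : c ∉ b.A := by
  obtain ⟨T, hcT, hT⟩ := fresh_iff.1 h
  intro hc
  obtain ⟨d, hd⟩ := exists_notMem (b.A ∪ T)
  simp only [Finset.mem_union, not_or] at hd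
  have h1 : transp c d • b = b := hT _ (fun e he =>
    transp_of_ne (fun h => hcT (h ▸ he)) (fun h => hd.2 (h ▸ he)))
  have h2 : transp c d • c ∈ (transp c d • b).A := smul_mem_A.2 hc
  rw [h1, transp_left] at h2
  exact hd.1 h2

theorem fresh_ne_a {b : OpenBox f ε} {c : 𝔸} (h : Fresh 𝔸 c b) : c ≠ b.a := fun e =>
  fresh_notMem h (e ▸ b.a_mem)

theorem fresh_y {b : OpenBox f ε} {c : 𝔸} (h : Fresh 𝔸 c b) : Fresh 𝔸 c b.y :=
  h.map (F := OpenBox.y) (fun _ _ => rfl)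

theorem fresh_u {b : OpenBox f ε} {c : 𝔸} (h : Fresh 𝔸 c b) (d : 𝔸) (i : Bool)
    (hd : Face b.A b.a ε d i) : Fresh 𝔸 c (b.u d i hd) := by
  obtain ⟨T, hcT, hT⟩ := fresh_iff.1 h
  have hdc : c ≠ d := fun e => fresh_notMem h (e ▸ hd.1)
  refine fresh_iff.2 ⟨insert d T, by simp [hcT, hdc], fun π hπ => ?_⟩
  have h1 : π • b = b := hT _ (fun e he => hπ (by simp [Finset.mem_coe.1 he]))
  have h2 : π • d = d := hπ (a := d) (by simp)
  rw [← smul_u_smul π b d i (smul_face.2 hd) hd, u_congr _ h2 _ (by rw [h1]; exact hd),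
    u_eq h1]

theorem smul_box_sub (π : FinPerm 𝔸) (b : OpenBox f ε) (c : 𝔸) (j : Bool) (hc : c ∉ b.A) :
    π • b.sub c j hc = (π • b).sub (π • c) j (fun h => hc (smul_mem_A.1 h)) := by
  refine ext' rfl rfl (ZeroOneSet.smul_sub _ _ _ _) ?_
  intro d i h h'
  exact ZeroOneSet.smul_sub _ _ _ _

theorem sub_of_fresh {b : OpenBox f ε} {c : 𝔸} (h : Fresh 𝔸 c b) (j : Bool) :
    b.sub c j (fresh_notMem h) = b := by
  refine ext' rfl rfl (ZeroOneSet.sub_of_fresh _ _ _ (fresh_y h)) ?_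
  intro d i h1 h2
  exact ZeroOneSet.sub_of_fresh _ _ _ (fresh_u h d i h1)

theorem fresh_of_parts {b : OpenBox f ε} {c : 𝔸} (hA : c ∉ b.A) (hy : Fresh 𝔸 c b.y)
    (hu : ∀ d i h, Fresh 𝔸 c (b.u d i h)) : Fresh 𝔸 c b := by
  obtain ⟨e, he1, he⟩ := exists_fresh (𝔸 := 𝔸) (insert c b.A) b
  simp only [Finset.mem_insert, not_or] at he1
  have key : transp e c • b = b := by
    have hfix : ∀ d ∈ b.A, transp e c • d = d := fun d hd =>
      transp_of_ne (fun h => he1.2 (h ▸ hd)) (fun h => hA (h ▸ hd))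
    refine ext' ?_ (hfix _ b.a_mem) (transp_fresh (fresh_y he) hy) ?_
    · rw [smul_A]
      refine Finset.map_eq_of_subset ?_
      intro x hx
      obtain ⟨d, hd, rfl⟩ := Finset.mem_map.1 hx
      change transp e c • d ∈ b.A
      rwa [hfix d hd]
    · intro d i h h'
      have hd := hfix d h'.1
      rw [smul_u, b.u_congr (inv_smul_eq_iff.2 hd.symm) _ h',
        transp_fresh (fresh_u he d i h') (hu d i h')]
  have := he.smul (transp e c)
  rwa [transp_left, key] at this

theorem fresh_box_sub (b : OpenBox f ε) (c : 𝔸) (j : Bool) (hc : c ∉ b.A) :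
    Fresh 𝔸 c (b.sub c j hc) :=
  fresh_of_parts hc (ZeroOneSet.fresh_sub _ _ _) (fun _ _ _ => ZeroOneSet.fresh_sub _ _ _)

end basic

section map

variable {X Y Z V : Sub01 𝔸} {f : X ⟶ Y} {g : Z ⟶ V} {ε : Bool}
variable [Infinite 𝔸]

/-- The image `(φ ∘ u, k(y))` of an open box under a commutative square `(φ, k) : f ⟶ g`. -/
def map (b : OpenBox f ε) (φ : X ⟶ Z) (k : Y ⟶ V) (sq : ∀ x, g (φ x) = k (f x)) :
    OpenBox g ε where
  A := b.A
  a := b.a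
  a_mem := b.a_mem
  u := fun d i h => φ (b.u d i h)
  y := k b.y
  fresh := fun d i h => (b.fresh d i h).map (map_smul φ)
  adj := fun d i h d' i' h' hne => by rw [← map_sub, ← map_sub, b.adj d i h d' i' h' hne]
  proj := fun d i h => by rw [sq, b.proj, map_sub]

theorem map_smul (b : OpenBox f ε) (φ : X ⟶ Z) (k : Y ⟶ V) (sq : ∀ x, g (φ x) = k (f x))
    (π : FinPerm 𝔸) : (π • b).map φ k sq = π • b.map φ k sq :=
  ext' rfl rfl (ZeroOne.map_smul _ _ _) (fun _ _ _ _ => ZeroOne.map_smul _ _ _)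

theorem map_sub (b : OpenBox f ε) (φ : X ⟶ Z) (k : Y ⟶ V) (sq : ∀ x, g (φ x) = k (f x))
    (c : 𝔸) (j : Bool) (hc : c ∉ b.A) :
    (b.sub c j hc).map φ k sq = (b.map φ k sq).sub c j hc :=
  ext' rfl rfl (ZeroOne.map_sub _ _ _ _) (fun _ _ _ _ => ZeroOne.map_sub _ _ _ _)

end map

end OpenBox

variable [Infinite 𝔸]

/-- A Kan filling operator for `ε`-open boxes over `f`: a choice of filler for each box that
satisfies the two uniformity conditions. -/
structure KanFilling {X Y : Sub01 𝔸} (f : X ⟶ Y) (ε : Bool) where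
  fill : OpenBox f ε → X
  fill_side : ∀ (b : OpenBox f ε) c i h, sub (fill b) c i = b.u c i h
  fill_proj : ∀ b, f (fill b) = b.y
  fill_smul : ∀ (π : FinPerm 𝔸) b, fill (π • b) = π • fill b
  fill_sub : ∀ (b : OpenBox f ε) c i (hc : c ∉ b.A), fill (b.sub c i hc) = sub (fill b) c i

/-- `f` is a Kan fibration if it admits Kan filling operators for `1`-open boxes and for
`0`-open boxes. -/
def IsKanFibration {X Y : Sub01 𝔸} (f : X ⟶ Y) : Prop :=
  Nonempty (KanFilling f true) ∧ Nonempty (KanFilling f false)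

/-! ### Compositions -/

/-- The set of all `⟨a⟩(u, y)`, where `(u, y)` is an `ε`-open `(A, a)`-box for some `A`. This is
the image in the name abstraction of the set of pairs `(a, (u, y))`; as `a` is determined by
`u`, it is the quotient of the set of boxes by `α`-equivalence of these pairs. -/
def Comp {X Y : Sub01 𝔸} (f : X ⟶ Y) (ε : Bool) : Type u :=
  Quot fun b b' : OpenBox f ε => AlphaEquiv 𝔸 (b.a, b) (b'.a, b')

namespace Comp

variable {X Y Z V : Sub01 𝔸} {f : X ⟶ Y} {g : Z ⟶ V} {ε : Bool}

/-- The element `⟨a⟩(u, y)` for an open `(A, a)`-box `(u, y)`. -/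
def mk (b : OpenBox f ε) : Comp f ε := Quot.mk _ b

theorem mk_transp (b : OpenBox f ε) (d : 𝔸) (hd : Fresh 𝔸 d b) :
    mk (transp d b.a • b) = mk b := by
  obtain ⟨e, he, heb⟩ := exists_fresh (𝔸 := 𝔸) {d, b.a} b
  simp only [Finset.mem_insert, Finset.mem_singleton, not_or] at he
  have hda := OpenBox.fresh_ne_a hd
  have he' : transp d b.a • e = e := transp_of_ne he.1 he.2
  refine Quot.sound ⟨e, ?_, ?_, fresh_name.2 he.2, heb, ?_⟩
  · rw [fresh_name, OpenBox.smul_a, transp_right]; exact he.1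
  · have := heb.smul (transp d b.a)
    rwa [he'] at this
  · dsimp only
    rw [OpenBox.smul_a, transp_right, smul_transp_smul, transp_right,
      transp_of_ne (Ne.symm he.2) (Ne.symm hda), transp_fresh heb hd]

theorem sound {W : Type*} (F : OpenBox f ε → W)
    (hF : ∀ b d, Fresh 𝔸 d b → F (transp d b.a • b) = F b) (b b' : OpenBox f ε)
    (h : AlphaEquiv 𝔸 (b.a, b) (b'.a, b')) : F b = F b' := by
  obtain ⟨c, _, h2, _, h4, h5⟩ := h
  dsimp only at h2 h4 h5
  rw [← hF b c h2, ← hF b' c h4, h5]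

/-- A function that is invariant under renaming the bound name descends to `Comp`. -/
def lift {W : Type*} (F : OpenBox f ε → W)
    (hF : ∀ b d, Fresh 𝔸 d b → F (transp d b.a • b) = F b) : Comp f ε → W :=
  Quot.lift F (sound F hF)

theorem ind {C : Comp f ε → Prop} (h : ∀ b, C (mk b)) (q : Comp f ε) : C q := Quot.ind h q

theorem exists_rep (S : Finset 𝔸) (q : Comp f ε) : ∃ b, q = mk b ∧ b.a ∉ S := by
  induction q using ind with | h b =>
  obtain ⟨e, he, heb⟩ := exists_fresh (𝔸 := 𝔸) S b
  exact ⟨transp e b.a • b, (mk_transp b e heb).symm, by simpa using he⟩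

instance : MulAction (FinPerm 𝔸) (Comp f ε) where
  smul π := lift (fun b => mk (π • b)) (fun b d hd => by
    rw [smul_transp_smul]
    exact mk_transp (π • b) (π • d) (hd.smul π))
  one_smul q := by
    induction q using ind with | h b =>
    exact congrArg mk (one_smul _ b)
  mul_smul π σ q := by
    induction q using ind with | h b =>
    exact congrArg mk (mul_smul π σ b)

theorem smul_mk (π : FinPerm 𝔸) (b : OpenBox f ε) : π • mk b = mk (π • b) := rfl

instance : NominalSet 𝔸 (Comp f ε) where
  exists_support q := by
    induction q using ind with | h b =>
    obtain ⟨S, hS⟩ := NominalSet.exists_support (𝔸 := 𝔸) b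
    exact ⟨S, fun π hπ => by rw [smul_mk, hS π hπ]⟩

theorem fresh_mk_of_fresh {b : OpenBox f ε} {c : 𝔸} (h : Fresh 𝔸 c b) : Fresh 𝔸 c (mk b) :=
  h.map (F := mk) (fun _ _ => rfl)

theorem fresh_mk (b : OpenBox f ε) : Fresh 𝔸 b.a (mk b) := by
  obtain ⟨e, he, heb⟩ := exists_fresh (𝔸 := 𝔸) ∅ b
  rw [← mk_transp b e heb]
  apply fresh_mk_of_fresh
  have := heb.smul (transp e b.a)
  rwa [transp_left] at this

theorem transp_chain {b : OpenBox f ε} {d e a : 𝔸} (hd : Fresh 𝔸 d b) (he : Fresh 𝔸 e b)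
    (hda : d ≠ a) (hea : e ≠ a) : transp e d • transp d a • b = transp e a • b := by
  rw [smul_transp_smul, transp_right, transp_of_ne hea.symm hda.symm, transp_fresh he hd]

theorem exact {b b' : OpenBox f ε} (h : mk b = mk b') : AlphaEquiv 𝔸 (b.a, b) (b'.a, b') := by
  have step : ∀ (b' : OpenBox f ε) (d : 𝔸), Fresh 𝔸 d b' →
      AlphaEquiv 𝔸 (b.a, b) (b'.a, b') →
      AlphaEquiv 𝔸 (b.a, b) ((transp d b'.a • b').a, transp d b'.a • b') := by
    rintro b' d hd ⟨c, _, h2, _, h4, h5⟩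
    dsimp only at h2 h4 h5
    obtain ⟨e, he, heb⟩ := exists_fresh (𝔸 := 𝔸) (insert d (insert c (someSupp 𝔸 b'))) b
    simp only [Finset.mem_insert, not_or] at he
    obtain ⟨hed, hec, heb'⟩ := he
    replace heb' := fresh_of_notMem heb'
    have hea := OpenBox.fresh_ne_a heb
    have hea' := OpenBox.fresh_ne_a heb'
    have hda' := OpenBox.fresh_ne_a hd
    refine ⟨e, fresh_name.2 hea, heb, ?_, ?_, ?_⟩
    · rw [fresh_name, OpenBox.smul_a, transp_right]; exact hed
    · have := heb'.smul (transp d b'.a)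
      rwa [transp_of_ne hed hea'] at this
    · dsimp only
      rw [OpenBox.smul_a, transp_right, transp_chain hd heb' hda' hea',
        ← transp_chain h2 heb (OpenBox.fresh_ne_a h2) hea, h5,
        transp_chain h4 heb' (OpenBox.fresh_ne_a h4) hea']
  let F : Comp f ε → Prop := lift (fun b' => AlphaEquiv 𝔸 (b.a, b) (b'.a, b')) (by
    intro b' d hd
    refine propext ⟨fun h => ?_, step b' d hd⟩
    have h1 : Fresh 𝔸 b'.a (transp d b'.a • b') := by
      have := hd.smul (transp d b'.a)
      rwa [transp_left] at this
    have := step _ _ h1 h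
    rwa [OpenBox.smul_a, transp_right, OpenBox.smul_a, transp_right, transp_comm,
      transp_transp] at this)
  have h1 : F (mk b) := by
    obtain ⟨e, he, heb⟩ := exists_fresh (𝔸 := 𝔸) ∅ b
    have hea := fresh_name.2 (OpenBox.fresh_ne_a heb)
    exact ⟨e, hea, heb, hea, heb, rfl⟩
  rw [h] at h1
  exact h1

/-- The image of `⟨a⟩(u, y)` under a commutative square. -/
def map (q : Comp f ε) (φ : X ⟶ Z) (k : Y ⟶ V) (sq : ∀ x, g (φ x) = k (f x)) : Comp g ε :=
  lift (fun b => mk (b.map φ k sq)) (fun b d hd => by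
    rw [OpenBox.map_smul]
    exact mk_transp _ d (hd.map (F := fun b => b.map φ k sq)
      (fun π b => b.map_smul φ k sq π))) q

theorem map_mk (b : OpenBox f ε) (φ : X ⟶ Z) (k : Y ⟶ V) (sq : ∀ x, g (φ x) = k (f x)) :
    (mk b).map φ k sq = mk (b.map φ k sq) := rfl

end Comp

/-! ### The stages of the construction -/

section stages

variable {X Y P : Sub01 𝔸}

/-- For `f : X ⟶ Y` and `r : P ⟶ Y`, the nominal set
`X ⨿ P^↑ ⨿ P^+ ⨿ P^↓ ⨿ P^-`, where `P^↑` and `P^↓` (`fill true` and `fill false`) consist of the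
`1`-open and `0`-open boxes in `P` over elements of `Y`, and `P^+` and `P^-` (`comp true` and
`comp false`) of the `⟨a⟩(u, y)` for open `(A, a)`-boxes `(u, y)`. -/
inductive Pre (f : X ⟶ Y) (r : P ⟶ Y) : Type u
  | pt (x : X) : Pre f r
  | fill (ε : Bool) (b : OpenBox r ε) : Pre f r
  | comp (ε : Bool) (q : Comp r ε) : Pre f r

namespace Pre

variable {f : X ⟶ Y} {r : P ⟶ Y}

instance : MulAction (FinPerm 𝔸) (Pre f r) where
  smul π
    | pt x => pt (π • x)
    | fill ε b => fill ε (π • b)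
    | comp ε q => comp ε (π • q)
  one_smul
    | pt x => congrArg pt (one_smul _ x)
    | fill ε b => congrArg (fill ε) (one_smul _ b)
    | comp ε q => congrArg (comp ε) (one_smul _ q)
  mul_smul π σ
    | pt x => congrArg pt (mul_smul π σ x)
    | fill ε b => congrArg (fill ε) (mul_smul π σ b)
    | comp ε q => congrArg (comp ε) (mul_smul π σ q)

theorem smul_pt (π : FinPerm 𝔸) (x : X) : π • (pt x : Pre f r) = pt (π • x) := rfl
theorem smul_fill (π : FinPerm 𝔸) (ε : Bool) (b : OpenBox r ε) :
    π • (fill ε b : Pre f r) = fill ε (π • b) := rfl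
theorem smul_comp (π : FinPerm 𝔸) (ε : Bool) (q : Comp r ε) :
    π • (comp ε q : Pre f r) = comp ε (π • q) := rfl

instance : NominalSet 𝔸 (Pre f r) where
  exists_support
    | pt x => (NominalSet.exists_support x).imp fun _ h π hπ => by rw [smul_pt, h π hπ]
    | fill ε b => (NominalSet.exists_support b).imp fun _ h π hπ => by rw [smul_fill, h π hπ]
    | comp ε q => (NominalSet.exists_support q).imp fun _ h π hπ => by rw [smul_comp, h π hπ]

/-- The projection to `Y`: `x ↦ f(x)`, `(u, y) ↦ y` and `⟨a⟩(u, y) ↦ y(a := ε)`. -/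
def rho : Pre f r → Y
  | pt x => f x
  | fill _ b => b.y
  | comp ε q => q.lift (fun b => sub b.y b.a ε) (fun b d hd => by
      have h1 : sub (transp d b.a • b).y (transp d b.a • b).a ε =
          transp d b.a • sub b.y b.a ε := (ZeroOneSet.smul_sub _ _ _ _).symm
      rw [h1]
      exact transp_fresh ((OpenBox.fresh_y hd).sub_any _ _) (ZeroOneSet.fresh_sub _ _ _))

theorem rho_smul (π : FinPerm 𝔸) (p : Pre f r) : rho (π • p) = π • rho p := by
  cases p with
  | pt x => exact map_smul f π x
  | fill ε b => rfl
  | comp ε q =>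
    induction q using Comp.ind with | h b =>
    exact (ZeroOneSet.smul_sub _ _ _ _).symm

variable (j : P → Pre f r)

/-- Substitution in a box `(u, y)`: `(u, y)(c := i)` is `u(c, i)` for `(c, i) ∈ A × 2 \ {(a, ε)}`,
it is `⟨a⟩(u, y)` for `(c, i) = (a, ε)`, and `(u(c := i), y(c := i))` for `c ∉ A`. -/
def subBox {ε : Bool} (b : OpenBox r ε) (c : 𝔸) (i : Bool) : Pre f r :=
  if h : Face b.A b.a ε c i then j (b.u c i h)
  else if hc : c ∈ b.A then comp ε (Comp.mk b)
  else fill ε (b.sub c i hc)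

/-- Substitution in `⟨a⟩(u, y)`: for `c ≠ a`, `(⟨a⟩(u, y))(c := i)` is `u(c, i)(a := ε)` if
`c ∈ A`, and `⟨a⟩(u(c := i), y(c := i))` otherwise; substitution for the bound name has no
effect. -/
def subCompBox {ε : Bool} (b : OpenBox r ε) (c : 𝔸) (i : Bool) : Pre f r :=
  if h : c ∈ b.A then
    if ha : c = b.a then comp ε (Comp.mk b)
    else j (sub (b.u c i ⟨h, fun e => ha (congrArg Prod.fst e)⟩) b.a ε)
  else comp ε (Comp.mk (b.sub c i h))

variable {j}

theorem subBox_face {ε : Bool} (b : OpenBox r ε) (c : 𝔸) (i : Bool) (h : Face b.A b.a ε c i) :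
    subBox j b c i = j (b.u c i h) := dif_pos h

theorem subBox_end {ε : Bool} (b : OpenBox r ε) :
    subBox j b b.a ε = comp ε (Comp.mk b) := by
  rw [subBox, dif_neg (fun h => h.2 rfl), dif_pos b.a_mem]

theorem subBox_notMem {ε : Bool} (b : OpenBox r ε) (c : 𝔸) (i : Bool) (h : c ∉ b.A) :
    subBox j b c i = fill ε (b.sub c i h) := by
  rw [subBox, dif_neg (fun h' => h h'.1), dif_neg h]

/-- The three cases of substitution in a box. -/
theorem box_cases {ε : Bool} (b : OpenBox r ε) (c : 𝔸) (i : Bool) :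
    Face b.A b.a ε c i ∨ (c = b.a ∧ i = ε) ∨ c ∉ b.A := by
  by_cases h : c ∈ b.A
  · by_cases h' : c = b.a ∧ i = ε
    · exact Or.inr (Or.inl h')
    · exact Or.inl ⟨h, fun e => h' (by simpa using e)⟩
  · exact Or.inr (Or.inr h)

theorem face_of_ne {ε : Bool} {b : OpenBox r ε} {c : 𝔸} (h : c ∈ b.A) (ha : c ≠ b.a) (i : Bool) :
    Face b.A b.a ε c i := ⟨h, fun e => ha (congrArg Prod.fst e)⟩

theorem subCompBox_mem {ε : Bool} (b : OpenBox r ε) (c : 𝔸) (i : Bool) (h : c ∈ b.A)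
    (ha : c ≠ b.a) :
    subCompBox j b c i = j (sub (b.u c i (face_of_ne h ha i)) b.a ε) := by
  rw [subCompBox, dif_pos h, dif_neg ha]

theorem subCompBox_bound {ε : Bool} (b : OpenBox r ε) (i : Bool) :
    subCompBox j b b.a i = comp ε (Comp.mk b) := by
  rw [subCompBox, dif_pos b.a_mem, dif_pos rfl]

theorem subCompBox_notMem {ε : Bool} (b : OpenBox r ε) (c : 𝔸) (i : Bool) (h : c ∉ b.A) :
    subCompBox j b c i = comp ε (Comp.mk (b.sub c i h)) := by
  rw [subCompBox, dif_neg h]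

theorem subCompBox_fresh {ε : Bool} (b : OpenBox r ε) (c : 𝔸) (i : Bool) (h : Fresh 𝔸 c b) :
    subCompBox j b c i = comp ε (Comp.mk b) := by
  rw [subCompBox_notMem b c i (OpenBox.fresh_notMem h), OpenBox.sub_of_fresh h]

theorem smul_subBox (hj : ∀ (π : FinPerm 𝔸) p, j (π • p) = π • j p) (π : FinPerm 𝔸) {ε : Bool}
    (b : OpenBox r ε) (c : 𝔸) (i : Bool) :
    π • subBox j b c i = subBox j (π • b) (π • c) i := by
  rcases box_cases b c i with h | ⟨rfl, rfl⟩ | h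
  · rw [subBox_face b c i h, subBox_face _ _ _ (OpenBox.smul_face.2 h),
      OpenBox.smul_u_smul π b c i _ h, hj]
  · rw [subBox_end, ← OpenBox.smul_a, subBox_end]; rfl
  · rw [subBox_notMem b c i h, subBox_notMem _ _ _ (fun h' => h (OpenBox.smul_mem_A.1 h')),
      smul_fill, OpenBox.smul_box_sub]

theorem smul_subCompBox (hj : ∀ (π : FinPerm 𝔸) p, j (π • p) = π • j p) (π : FinPerm 𝔸)
    {ε : Bool} (b : OpenBox r ε) (c : 𝔸) (i : Bool) :
    π • subCompBox j b c i = subCompBox j (π • b) (π • c) i := by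
  by_cases h : c ∈ b.A
  · by_cases ha : c = b.a
    · subst ha
      rw [subCompBox_bound, ← OpenBox.smul_a, subCompBox_bound]; rfl
    · rw [subCompBox_mem b c i h ha, subCompBox_mem _ _ _ (OpenBox.smul_mem_A.2 h)
        (fun e => ha (smul_left_cancel _ e)), ← hj, ZeroOneSet.smul_sub,
        OpenBox.smul_u_smul π b c i _ (face_of_ne h ha i), OpenBox.smul_a]
  · rw [subCompBox_notMem b c i h, subCompBox_notMem _ _ _ (fun h' => h (OpenBox.smul_mem_A.1 h')),
      smul_comp, Comp.smul_mk, OpenBox.smul_box_sub]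

theorem fresh_pt {c : 𝔸} {x : X} (h : Fresh 𝔸 c x) : Fresh 𝔸 c (pt x : Pre f r) :=
  h.map (F := pt) (fun _ _ => rfl)

theorem fresh_fill {c : 𝔸} {ε : Bool} {b : OpenBox r ε} (h : Fresh 𝔸 c b) :
    Fresh 𝔸 c (fill ε b : Pre f r) := h.map (F := fill ε) (fun _ _ => rfl)

theorem fresh_comp {c : 𝔸} {ε : Bool} {b : Comp r ε} (h : Fresh 𝔸 c b) :
    Fresh 𝔸 c (comp ε b : Pre f r) := h.map (F := comp ε) (fun _ _ => rfl)

/-- `subCompBox` is invariant under renaming the bound name. -/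
theorem subCompBox_transp (hj : ∀ (π : FinPerm 𝔸) p, j (π • p) = π • j p) {ε : Bool} (c : 𝔸)
    (i : Bool) (b : OpenBox r ε) (d : 𝔸) (hd : Fresh 𝔸 d b) :
    subCompBox j (transp d b.a • b) c i = subCompBox j b c i := by
  have hda := OpenBox.fresh_ne_a hd
  by_cases hcd : c = d
  · subst hcd
    have h1 : c = (transp c b.a • b).a := by simp
    rw [subCompBox_fresh b c i hd]
    conv_lhs => rw [h1]
    conv_lhs => rw [← h1]
    have h2 := subCompBox_bound (j := j) (transp c b.a • b) i
    rw [OpenBox.smul_a, transp_right] at h2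
    rw [h2, Comp.mk_transp b c hd]
  by_cases hca : c = b.a
  · subst hca
    have h1 : Fresh 𝔸 b.a (transp d b.a • b) := by
      have := hd.smul (transp d b.a)
      rwa [transp_left] at this
    rw [subCompBox_fresh _ _ _ h1, subCompBox_bound, Comp.mk_transp b d hd]
  · have h1 := smul_subCompBox hj (transp d b.a) b c i
    rw [transp_of_ne hcd hca] at h1
    rw [← h1]
    apply transp_fresh
    · by_cases h : c ∈ b.A
      · rw [subCompBox_mem b c i h hca]
        exact ((OpenBox.fresh_u hd _ _ _).sub_any _ _).map hj
      · rw [subCompBox_notMem b c i h]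
        refine fresh_comp (Comp.fresh_mk_of_fresh (OpenBox.fresh_of_parts ?_ ?_ ?_))
        · exact (show d ∉ b.A from OpenBox.fresh_notMem hd)
        · exact (OpenBox.fresh_y hd).sub_any _ _
        · exact fun e i' h' => (OpenBox.fresh_u hd e i' h').sub_any _ _
    · by_cases h : c ∈ b.A
      · rw [subCompBox_mem b c i h hca]
        exact (ZeroOneSet.fresh_sub _ _ _).map hj
      · rw [subCompBox_notMem b c i h]
        exact fresh_comp (Comp.fresh_mk (b.sub c i h))

/-- The substitution operation on `Pre f r`, for an equivariant `j : P → Pre f r`. -/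
def sub (j : P → Pre f r) (hj : ∀ (π : FinPerm 𝔸) p, j (π • p) = π • j p) :
    Pre f r → 𝔸 → Bool → Pre f r
  | pt x, c, i => pt (ZeroOneSet.sub x c i)
  | fill _ b, c, i => subBox j b c i
  | comp _ q, c, i => q.lift (fun b => subCompBox j b c i) (subCompBox_transp hj c i)

end Pre

/-- A stage of the construction: a 01-substitution set `P` over `Y` with an inclusion `j` of `P`
into `Pre f r` that commutes with permutations, substitutions and the projections to `Y`. -/
structure Stage (f : X ⟶ Y) where
  P : Sub01 𝔸
  r : P ⟶ Y
  j : P → Pre f r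
  j_smul : ∀ (π : FinPerm 𝔸) p, j (π • p) = π • j p
  j_rho : ∀ p, (j p).rho = r p
  j_sub : ∀ p c i, j (sub p c i) = Pre.sub j j_smul (j p) c i

namespace Stage

variable {f : X ⟶ Y} (s : Stage f)

theorem sub_comp_mk {ε : Bool} (b : OpenBox s.r ε) (c : 𝔸) (i : Bool) :
    Pre.sub s.j s.j_smul (.comp ε (Comp.mk b)) c i = Pre.subCompBox s.j b c i := rfl

theorem sub_fill {ε : Bool} (b : OpenBox s.r ε) (c : 𝔸) (i : Bool) :
    Pre.sub s.j s.j_smul (.fill ε b) c i = Pre.subBox s.j b c i := rfl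

theorem smul_sub (π : FinPerm 𝔸) (p : Pre f s.r) (c : 𝔸) (i : Bool) :
    π • Pre.sub s.j s.j_smul p c i = Pre.sub s.j s.j_smul (π • p) (π • c) i := by
  cases p with
  | pt x => exact congrArg Pre.pt (ZeroOneSet.smul_sub _ _ _ _)
  | fill ε b => exact Pre.smul_subBox s.j_smul _ _ _ _
  | comp ε q =>
    induction q using Comp.ind with | h b =>
    exact Pre.smul_subCompBox s.j_smul _ _ _ _

theorem fresh_sub (p : Pre f s.r) (c : 𝔸) (i : Bool) :
    Fresh 𝔸 c (Pre.sub s.j s.j_smul p c i) := by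
  cases p with
  | pt x => exact Pre.fresh_pt (ZeroOneSet.fresh_sub _ _ _)
  | fill ε b =>
    rw [sub_fill]
    rcases Pre.box_cases b c i with h | ⟨rfl, rfl⟩ | h
    · rw [Pre.subBox_face _ _ _ h]
      exact (b.fresh _ _ _).map s.j_smul
    · rw [Pre.subBox_end]
      exact Pre.fresh_comp (Comp.fresh_mk b)
    · rw [Pre.subBox_notMem _ _ _ h]
      exact Pre.fresh_fill (OpenBox.fresh_box_sub _ _ _ _)
  | comp ε q =>
    obtain ⟨b, rfl, hb⟩ := Comp.exists_rep {c} q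
    replace hb : c ≠ b.a := fun e => hb (by simp [e])
    rw [sub_comp_mk]
    by_cases h : c ∈ b.A
    · rw [Pre.subCompBox_mem _ _ _ h hb]
      exact ((b.fresh _ _ _).sub_any _ _).map s.j_smul
    · rw [Pre.subCompBox_notMem _ _ _ h]
      exact Pre.fresh_comp (Comp.fresh_mk_of_fresh (OpenBox.fresh_box_sub _ _ _ _))

theorem fresh_of_fill {ε : Bool} {b : OpenBox s.r ε} {c : 𝔸}
    (h : Fresh 𝔸 c (Pre.fill ε b : Pre f s.r)) : Fresh 𝔸 c b := by
  obtain ⟨T, hcT, hT⟩ := fresh_iff.1 h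
  refine fresh_iff.2 ⟨T, hcT, fun π hπ => ?_⟩
  have := hT π hπ
  rw [Pre.smul_fill] at this
  exact Pre.fill.inj this |>.2 |> eq_of_heq

theorem sub_of_fresh (p : Pre f s.r) (c : 𝔸) (i : Bool) (h : Fresh 𝔸 c p) :
    Pre.sub s.j s.j_smul p c i = p := by
  cases p with
  | pt x =>
    refine congrArg Pre.pt (ZeroOneSet.sub_of_fresh _ _ _ ?_)
    obtain ⟨T, hcT, hT⟩ := fresh_iff.1 h
    exact fresh_iff.2 ⟨T, hcT, fun π hπ => Pre.pt.inj (hT π hπ)⟩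
  | fill ε b =>
    replace h := s.fresh_of_fill h
    rw [sub_fill, Pre.subBox_notMem _ _ _ (OpenBox.fresh_notMem h), OpenBox.sub_of_fresh h]
  | comp ε q =>
    induction q using Comp.ind with | h b =>
    obtain ⟨e, he, heb⟩ := exists_fresh (𝔸 := 𝔸) {c} b
    have h1 : Fresh 𝔸 e (Pre.comp ε (Comp.mk b) : Pre f s.r) :=
      Pre.fresh_comp (Comp.fresh_mk_of_fresh heb)
    have h2 := s.smul_sub (transp e c) (.comp ε (Comp.mk b)) e i
    rw [transp_fresh h1 h, transp_left, sub_comp_mk, Pre.subCompBox_fresh _ _ _ heb,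
      transp_fresh h1 h] at h2
    exact h2.symm

theorem sub_j (p : s.P) (c : 𝔸) (i : Bool) :
    Pre.sub s.j s.j_smul (s.j p) c i = s.j (sub p c i) := (s.j_sub p c i).symm

theorem sub_comm_fill {ε : Bool} (b : OpenBox s.r ε) (c : 𝔸) (i : Bool) (c' : 𝔸) (i' : Bool)
    (h : c ≠ c') (h1 : Face b.A b.a ε c i) :
    Pre.sub s.j s.j_smul (Pre.subBox s.j b c i) c' i' =
      Pre.sub s.j s.j_smul (Pre.subBox s.j b c' i') c i := by
  rw [Pre.subBox_face _ _ _ h1, sub_j]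
  rcases Pre.box_cases b c' i' with h2 | ⟨rfl, rfl⟩ | h2
  · rw [Pre.subBox_face _ _ _ h2, sub_j, b.adj _ _ _ _ _ _ h]
  · rw [Pre.subBox_end, sub_comp_mk, Pre.subCompBox_mem _ _ _ h1.1 h]
  · rw [Pre.subBox_notMem _ _ _ h2, sub_fill,
      Pre.subBox_face _ _ _ (show Face (b.sub c' i' h2).A _ _ _ _ from h1)]
    rfl

theorem sub_comm (p : Pre f s.r) (c : 𝔸) (i : Bool) (c' : 𝔸) (i' : Bool) (h : c ≠ c') :
    Pre.sub s.j s.j_smul (Pre.sub s.j s.j_smul p c i) c' i' =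
      Pre.sub s.j s.j_smul (Pre.sub s.j s.j_smul p c' i') c i := by
  cases p with
  | pt x => exact congrArg Pre.pt (ZeroOneSet.sub_comm _ _ _ _ _ h)
  | fill ε b =>
    rw [sub_fill, sub_fill]
    rcases Pre.box_cases b c i with h1 | h1 | h1
    · exact s.sub_comm_fill b c i c' i' h h1
    · rcases Pre.box_cases b c' i' with h2 | h2 | h2
      · exact (s.sub_comm_fill b c' i' c i h.symm h2).symm
      · exact absurd (h1.1.trans h2.1.symm) h
      · obtain ⟨rfl, rfl⟩ := h1
        rw [Pre.subBox_end, Pre.subBox_notMem _ _ _ h2, sub_comp_mk,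
          Pre.subCompBox_notMem _ _ _ h2, sub_fill]
        exact (Pre.subBox_end (b.sub c' i' h2)).symm
    · rcases Pre.box_cases b c' i' with h2 | h2 | h2
      · exact (s.sub_comm_fill b c' i' c i h.symm h2).symm
      · obtain ⟨rfl, rfl⟩ := h2
        rw [Pre.subBox_end, Pre.subBox_notMem _ _ _ h1, sub_comp_mk,
          Pre.subCompBox_notMem _ _ _ h1, sub_fill]
        exact Pre.subBox_end (b.sub c i h1)
      · rw [Pre.subBox_notMem _ _ _ h1, Pre.subBox_notMem _ _ _ h2, sub_fill, sub_fill,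
          Pre.subBox_notMem _ _ _ (show c' ∉ (b.sub c i h1).A from h2),
          Pre.subBox_notMem _ _ _ (show c ∉ (b.sub c' i' h2).A from h1)]
        refine congrArg (Pre.fill ε) (OpenBox.ext' rfl rfl (ZeroOneSet.sub_comm _ _ _ _ _ h) ?_)
        exact fun d k _ _ => ZeroOneSet.sub_comm _ _ _ _ _ h
  | comp ε q =>
    obtain ⟨b, rfl, hb⟩ := Comp.exists_rep {c, c'} q
    simp only [Finset.mem_insert, Finset.mem_singleton, not_or] at hb
    obtain ⟨hbc, hbc'⟩ := hb
    rw [sub_comp_mk, sub_comp_mk]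
    have key : ∀ (c : 𝔸) (i : Bool) (c' : 𝔸) (i' : Bool), c ≠ c' → c ≠ b.a → c' ≠ b.a →
        c ∈ b.A →
        Pre.sub s.j s.j_smul (Pre.subCompBox s.j b c i) c' i' =
          Pre.sub s.j s.j_smul (Pre.subCompBox s.j b c' i') c i := by
      intro c i c' i' h hbc hbc' h1
      rw [Pre.subCompBox_mem _ _ _ h1 hbc, sub_j, ZeroOneSet.sub_comm _ _ _ _ _ hbc'.symm]
      by_cases h2 : c' ∈ b.A
      · rw [Pre.subCompBox_mem _ _ _ h2 hbc', sub_j, ZeroOneSet.sub_comm _ _ _ _ _ hbc.symm,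
          b.adj _ _ _ _ _ _ h]
      · rw [Pre.subCompBox_notMem _ _ _ h2, sub_comp_mk]
        exact (Pre.subCompBox_mem (b.sub c' i' h2) c i h1 hbc).symm
    by_cases h1 : c ∈ b.A
    · exact key c i c' i' h (Ne.symm hbc) (Ne.symm hbc') h1
    by_cases h2 : c' ∈ b.A
    · exact (key c' i' c i h.symm (Ne.symm hbc') (Ne.symm hbc) h2).symm
    rw [Pre.subCompBox_notMem _ _ _ h1, Pre.subCompBox_notMem _ _ _ h2, sub_comp_mk, sub_comp_mk,
      Pre.subCompBox_notMem _ _ _ (show c' ∉ (b.sub c i h1).A from h2),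
      Pre.subCompBox_notMem _ _ _ (show c ∉ (b.sub c' i' h2).A from h1)]
    refine congrArg (fun b => Pre.comp ε (Comp.mk b))
      (OpenBox.ext' rfl rfl (ZeroOneSet.sub_comm _ _ _ _ _ h) ?_)
    exact fun d k _ _ => ZeroOneSet.sub_comm _ _ _ _ _ h

/-- The 01-substitution set `Pre f r` of a stage. -/
def nextP : Sub01 𝔸 where
  carrier := Pre f s.r
  str :=
    { sub := Pre.sub s.j s.j_smul
      smul_sub := s.smul_sub
      fresh_sub := s.fresh_sub
      sub_of_fresh := s.sub_of_fresh
      sub_comm := s.sub_comm }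

/-- The projection of the next stage to `Y`. -/
def nextR : s.nextP ⟶ Y where
  toFun := Pre.rho
  map_smul' := Pre.rho_smul
  map_sub' := by
    intro p c i
    change Pre.rho (Pre.sub s.j s.j_smul p c i) = _
    cases p with
    | pt x => exact map_sub f x c i
    | fill ε b =>
      rw [sub_fill]
      rcases Pre.box_cases b c i with h | ⟨rfl, rfl⟩ | h
      · rw [Pre.subBox_face _ _ _ h, s.j_rho, b.proj]; rfl
      · rw [Pre.subBox_end]; rfl
      · rw [Pre.subBox_notMem _ _ _ h]; rfl
    | comp ε q =>
      obtain ⟨b, rfl, hb⟩ := Comp.exists_rep {c} q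
      replace hb : c ≠ b.a := fun e => hb (by simp [e])
      rw [sub_comp_mk]
      by_cases h : c ∈ b.A
      · rw [Pre.subCompBox_mem _ _ _ h hb, s.j_rho, map_sub, b.proj]
        exact ZeroOneSet.sub_comm _ _ _ _ _ hb
      · rw [Pre.subCompBox_notMem _ _ _ h]
        exact ZeroOneSet.sub_comm _ _ _ _ _ hb

/-- The inclusion of a stage into the next one. -/
def jHom : s.P ⟶ s.nextP where
  toFun := s.j
  map_smul' := s.j_smul
  map_sub' := s.j_sub

theorem j_sq (p : s.P) : s.nextR (s.jHom p) = (𝟙 Y : Y ⟶ Y) (s.r p) := s.j_rho p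

/-- The map `Pre f s.r → Pre f s.nextR` that is induced componentwise by `j`. -/
def nextJ : Pre f s.r → Pre f s.nextR
  | .pt x => .pt x
  | .fill ε b => .fill ε (b.map s.jHom (𝟙 Y) s.j_sq)
  | .comp ε q => .comp ε (q.map s.jHom (𝟙 Y) s.j_sq)

theorem nextJ_subBox {ε : Bool} (b : OpenBox s.r ε) (c : 𝔸) (i : Bool) :
    s.nextJ (Pre.subBox s.j b c i) =
      Pre.subBox (P := s.nextP) s.nextJ (b.map s.jHom (𝟙 Y) s.j_sq) c i := by
  rcases Pre.box_cases b c i with h | ⟨rfl, rfl⟩ | h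
  · rw [Pre.subBox_face _ _ _ h]
    exact (Pre.subBox_face (b.map s.jHom (𝟙 Y) s.j_sq) c i h).symm
  · rw [Pre.subBox_end]
    exact (Pre.subBox_end (b.map s.jHom (𝟙 Y) s.j_sq)).symm
  · rw [Pre.subBox_notMem _ _ _ h]
    refine Eq.trans ?_ (Pre.subBox_notMem (b.map s.jHom (𝟙 Y) s.j_sq) c i h).symm
    exact congrArg (Pre.fill ε) (b.map_sub _ _ _ c i h)

theorem nextJ_subCompBox {ε : Bool} (b : OpenBox s.r ε) (c : 𝔸) (i : Bool) (hb : c ≠ b.a) :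
    s.nextJ (Pre.subCompBox s.j b c i) =
      Pre.subCompBox (P := s.nextP) s.nextJ (b.map s.jHom (𝟙 Y) s.j_sq) c i := by
  by_cases h : c ∈ b.A
  · rw [Pre.subCompBox_mem _ _ _ h hb]
    refine Eq.trans ?_ (Pre.subCompBox_mem (b.map s.jHom (𝟙 Y) s.j_sq) c i h hb).symm
    exact congrArg s.nextJ (map_sub s.jHom _ _ _)
  · rw [Pre.subCompBox_notMem _ _ _ h]
    refine Eq.trans ?_ (Pre.subCompBox_notMem (b.map s.jHom (𝟙 Y) s.j_sq) c i h).symm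
    exact congrArg (fun b => Pre.comp ε (Comp.mk b)) (b.map_sub _ _ _ c i h)

/-- The next stage; its inclusion is defined componentwise from the inclusion `j`. -/
def next : Stage f where
  P := s.nextP
  r := s.nextR
  j := s.nextJ
  j_smul π p := by
    cases p with
    | pt x => rfl
    | fill ε b => exact congrArg (Pre.fill ε) (b.map_smul _ _ _ π)
    | comp ε q =>
      induction q using Comp.ind with | h b =>
      exact congrArg (fun b => Pre.comp ε (Comp.mk b)) (b.map_smul _ _ _ π)
  j_rho p := by
    cases p with
    | pt x => rfl
    | fill ε b => rfl
    | comp ε q =>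
      induction q using Comp.ind with | h b =>
      rfl
  j_sub p c i := by
    cases p with
    | pt x => rfl
    | fill ε b => exact s.nextJ_subBox b c i
    | comp ε q =>
      obtain ⟨b, rfl, hb⟩ := Comp.exists_rep {c} q
      exact s.nextJ_subCompBox b c i (fun e => hb (by simp [e]))

theorem nextJ_injective (h : Function.Injective s.j) : Function.Injective s.nextJ := by
  have hbox : ∀ {ε : Bool} (b b' : OpenBox s.r ε),
      (b.map s.jHom (𝟙 Y) s.j_sq : OpenBox s.nextR ε) = b'.map s.jHom (𝟙 Y) s.j_sq →
      b = b' := by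
    intro ε b b' e
    refine OpenBox.ext' (congrArg OpenBox.A e :) (congrArg OpenBox.a e :)
      (congrArg OpenBox.y e :) ?_
    intro c i h1 h2
    exact h (OpenBox.u_eq e h1 h2)
  have hfresh : ∀ {ε : Bool} (b : OpenBox s.r ε) (c : 𝔸),
      Fresh 𝔸 c (b.map s.jHom (𝟙 Y) s.j_sq : OpenBox s.nextR ε) → Fresh 𝔸 c b := by
    intro ε b c hc
    obtain ⟨T, hcT, hT⟩ := fresh_iff.1 hc
    refine fresh_iff.2 ⟨T, hcT, fun π hπ => hbox _ _ ?_⟩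
    rw [OpenBox.map_smul]
    exact hT π hπ
  intro p q e
  cases p with
  | pt x => cases q with
    | pt y => exact congrArg _ (Pre.pt.inj e)
    | fill _ _ => cases e
    | comp _ _ => cases e
  | fill ε b => cases q with
    | pt y => cases e
    | fill ε' b' =>
      obtain ⟨rfl, e⟩ := Pre.fill.inj e
      exact congrArg _ (hbox _ _ (eq_of_heq e))
    | comp _ _ => cases e
  | comp ε q₀ => cases q with
    | pt y => cases e
    | fill _ _ => cases e
    | comp ε' q' =>
      obtain ⟨rfl, e⟩ := Pre.comp.inj e
      replace e := eq_of_heq e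
      induction q₀ using Comp.ind with | h b =>
      induction q' using Comp.ind with | h b' =>
      refine congrArg _ (Quot.sound ?_)
      obtain ⟨c, h1, h2, h3, h4, h5⟩ := Comp.exact e
      refine ⟨c, h1, hfresh _ _ h2, h3, hfresh _ _ h4, hbox _ _ ?_⟩
      rw [OpenBox.map_smul, OpenBox.map_smul]
      exact h5

end Stage

/-- The `n`-th stage `K_n f` with its inclusion into `K_(n+1) f`. There are no open boxes in the
empty set, so `K_0 f` is `X`; and `K_(n+1) f` is built from the open boxes in
`colim_(m < n + 1) K_m f`, which is `K_n f`. -/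
def stage (f : X ⟶ Y) : ℕ → Stage f
  | 0 =>
    { P := X
      r := f
      j := Pre.pt
      j_smul := fun _ _ => rfl
      j_rho := fun _ => rfl
      j_sub := fun _ _ _ => rfl }
  | n + 1 => (stage f n).next

theorem stage_j_injective (f : X ⟶ Y) (n : ℕ) : Function.Injective (stage f n).j := by
  induction n with
  | zero => exact fun _ _ e => Pre.pt.inj e
  | succ n ih => exact (stage f n).nextJ_injective ih

/-- The inclusion `K_n f ⟶ K_(n+1) f`. -/
def step (f : X ⟶ Y) (n : ℕ) : (stage f n).P ⟶ (stage f (n + 1)).P := (stage f n).jHom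

/-- The inclusion `K_n f ⟶ K_m f` for `n ≤ m`. -/
def trans (f : X ⟶ Y) (n m : ℕ) (h : n ≤ m) : (stage f n).P ⟶ (stage f m).P :=
  Nat.leRecOn (C := fun m => (stage f n).P ⟶ (stage f m).P) h
    (fun {k} φ => φ ≫ step f k) (𝟙 _)

theorem trans_self (f : X ⟶ Y) (n : ℕ) : trans f n n le_rfl = 𝟙 _ :=
  Nat.leRecOn_self (C := fun m => (stage f n).P ⟶ (stage f m).P) _

theorem trans_succ (f : X ⟶ Y) (n m : ℕ) (h : n ≤ m) (h' : n ≤ m + 1) :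
    trans f n (m + 1) h' = trans f n m h ≫ step f m :=
  Nat.leRecOn_succ (C := fun m => (stage f n).P ⟶ (stage f m).P) h _

instance (f : X ⟶ Y) : DirectedSystem (fun n => (stage f n).P.carrier)
    (fun n m h => (trans f n m h : (stage f n).P → (stage f m).P)) where
  map_self n x := by rw [trans_self]; rfl
  map_map k m n hnm hmk x := by
    induction k, hmk using Nat.le_induction with
    | base => rw [trans_self]; rfl
    | succ k hk ih => 
      rw [trans_succ f m k hk, trans_succ f n k (hnm.trans hk), comp_apply, ih, comp_apply]

theorem trans_injective (f : X ⟶ Y) (n m : ℕ) (h : n ≤ m) :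
    Function.Injective (trans f n m h) := by
  induction m, h using Nat.le_induction with
  | base => rw [trans_self]; exact fun _ _ e => e
  | succ k hk ih =>
    rw [trans_succ f n k hk]
    exact (stage_j_injective f k).comp ih

theorem trans_r (f : X ⟶ Y) (n m : ℕ) (h : n ≤ m) (x : (stage f n).P) :
    (stage f m).r (trans f n m h x) = (stage f n).r x := by
  induction m, h using Nat.le_induction with
  | base => rw [trans_self]; rfl
  | succ k hk ih =>
    rw [trans_succ f n k hk, ← ih, comp_apply]
    exact (stage f k).j_rho _

/-! ### The colimit of the stages -/

/-- The underlying set of `K f`: the colimit of the `K_n f`. -/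
abbrev KSet (f : X ⟶ Y) : Type u :=
  DirectLimit (fun n => (stage f n).P.carrier) (trans f)

instance (f : X ⟶ Y) : MulAction (FinPerm 𝔸) (KSet f) where
  smul π := DirectLimit.map _ _ (fun _ x => π • x) (fun _ _ _ _ => map_smul _ _ _)
  one_smul x := by
    induction x using DirectLimit.induction with | ih n x =>
    exact congrArg (fun z => (⟦⟨n, z⟩⟧ : KSet f)) (one_smul _ x)
  mul_smul π σ x := by
    induction x using DirectLimit.induction with | ih n x =>
    exact congrArg (fun z => (⟦⟨n, z⟩⟧ : KSet f)) (mul_smul π σ x)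

instance (f : X ⟶ Y) : NominalSet 𝔸 (KSet f) where
  exists_support x := by
    induction x using DirectLimit.induction with | ih n x =>
    obtain ⟨S, hS⟩ := NominalSet.exists_support (𝔸 := 𝔸) x
    exact ⟨S, fun π hπ => congrArg (fun z => (⟦⟨n, z⟩⟧ : KSet f)) (hS π hπ)⟩

/-- The 01-substitution set `K f`. -/
def K (f : X ⟶ Y) : Sub01 𝔸 where
  carrier := KSet f
  str :=
    { sub := fun x c i =>
        DirectLimit.map _ _ (fun _ x => sub x c i) (fun _ _ _ _ => map_sub _ _ _ _) x
      smul_sub := fun π x c i => by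
        induction x using DirectLimit.induction with | ih n x =>
        exact congrArg (fun z => (⟦⟨n, z⟩⟧ : KSet f)) (ZeroOneSet.smul_sub π x c i)
      fresh_sub := fun x c i => by
        induction x using DirectLimit.induction with | ih n x =>
        exact (ZeroOneSet.fresh_sub x c i).map (F := fun z => (⟦⟨n, z⟩⟧ : KSet f))
          (fun _ _ => rfl)
      sub_of_fresh := fun x c i h => by
        induction x using DirectLimit.induction with | ih n x =>
        refine congrArg (fun z => (⟦⟨n, z⟩⟧ : KSet f)) (ZeroOneSet.sub_of_fresh x c i ?_)
        obtain ⟨T, hcT, hT⟩ := fresh_iff.1 h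
        exact fresh_iff.2 ⟨T, hcT, fun π hπ =>
          DirectLimit.mk_injective (trans f) (trans_injective f) n (hT π hπ)⟩
      sub_comm := fun x c i c' i' h => by
        induction x using DirectLimit.induction with | ih n x =>
        exact congrArg (fun z => (⟦⟨n, z⟩⟧ : KSet f)) (ZeroOneSet.sub_comm x c i c' i' h) }

/-- The inclusion `K_n f ⟶ K f`. -/
def incl (f : X ⟶ Y) (n : ℕ) : (stage f n).P ⟶ K f where
  toFun x := (⟦⟨n, x⟩⟧ : KSet f)
  map_smul' _ _ := rfl
  map_sub' _ _ _ := rfl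

/-- The map `λ_f : X ⟶ K f`. -/
def lam (f : X ⟶ Y) : X ⟶ K f := incl f 0

/-- The map `ρ_f : K f ⟶ Y`. -/
def rho (f : X ⟶ Y) : K f ⟶ Y where
  toFun := DirectLimit.lift _ (fun n x => (stage f n).r x) (fun n m h x => (trans_r f n m h x).symm)
  map_smul' π x := by
    induction x using DirectLimit.induction with | ih n x =>
    exact map_smul (stage f n).r π x
  map_sub' x c i := by
    induction x using DirectLimit.induction with | ih n x =>
    exact map_sub (stage f n).r x c i

theorem lam_rho (f : X ⟶ Y) : lam f ≫ rho f = f := rfl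

theorem incl_rho (f : X ⟶ Y) (n : ℕ) (x : (stage f n).P) :
    rho f (incl f n x) = (stage f n).r x := rfl

theorem incl_surj (f : X ⟶ Y) (x : K f) : ∃ n y, x = incl f n y :=
  DirectLimit.exists_eq_mk (trans f) x

theorem incl_injective (f : X ⟶ Y) (n : ℕ) : Function.Injective (incl f n) :=
  DirectLimit.mk_injective (trans f) (trans_injective f) n

theorem incl_trans (f : X ⟶ Y) (n m : ℕ) (h : n ≤ m) (x : (stage f n).P) :
    incl f m (trans f n m h x) = incl f n x :=
  DirectLimit.mk_apply (F := fun n => (stage f n).P.carrier) (f := trans f) n m x h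

theorem incl_j (f : X ⟶ Y) (n : ℕ) (x : (stage f n).P) :
    incl f (n + 1) (step f n x) = incl f n x := by
  rw [← incl_trans f n (n + 1) (Nat.le_succ n), trans_succ f n n le_rfl, trans_self]; rfl

/-! ### Filling open boxes in `K f` -/

theorem incl_sq (f : X ⟶ Y) (n : ℕ) (x : (stage f n).P) :
    rho f (incl f n x) = (𝟙 Y : Y ⟶ Y) ((stage f n).r x) := rfl

theorem trans_sq (f : X ⟶ Y) (n m : ℕ) (h : n ≤ m) (x : (stage f n).P) :
    (stage f m).r (trans f n m h x) = (𝟙 Y : Y ⟶ Y) ((stage f n).r x) := trans_r f n m h x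

/-- An open box in `K_n f` as an open box in `K f`. -/
def boxIncl (f : X ⟶ Y) {ε : Bool} (n : ℕ) (b : OpenBox (stage f n).r ε) : OpenBox (rho f) ε :=
  b.map (incl f n) (𝟙 Y) (incl_sq f n)

/-- An open box in `K_n f` as an element of `K_(n+1) f`. -/
def stageFill (f : X ⟶ Y) {ε : Bool} (n : ℕ) (b : OpenBox (stage f n).r ε) :
    (stage f (n + 1)).P :=
  (Pre.fill ε b : Pre f (stage f n).r)

/-- The element `⟨a⟩(u, y)` of `K_(n+1) f` for an open box `(u, y)` in `K_n f`. -/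
def stageComp (f : X ⟶ Y) {ε : Bool} (n : ℕ) (b : OpenBox (stage f n).r ε) :
    (stage f (n + 1)).P :=
  (Pre.comp ε (Comp.mk b) : Pre f (stage f n).r)

theorem boxIncl_injective (f : X ⟶ Y) {ε : Bool} (n : ℕ) :
    Function.Injective (boxIncl f (ε := ε) n) := by
  intro b b' e
  refine OpenBox.ext' (congrArg OpenBox.A e :) (congrArg OpenBox.a e :) (congrArg OpenBox.y e :) ?_
  intro c i h1 h2
  exact incl_injective f n (OpenBox.u_eq e h1 h2)

theorem boxIncl_trans (f : X ⟶ Y) {ε : Bool} (n m : ℕ) (h : n ≤ m)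
    (b : OpenBox (stage f n).r ε) :
    boxIncl f m (b.map (trans f n m h) (𝟙 Y) (trans_sq f n m h)) = boxIncl f n b :=
  OpenBox.ext' rfl rfl rfl (fun _ _ _ _ => incl_trans f n m h _)

theorem incl_stageFill_trans (f : X ⟶ Y) {ε : Bool} (n m : ℕ) (h : n ≤ m)
    (b : OpenBox (stage f n).r ε) :
    incl f (m + 1) (stageFill f m (b.map (trans f n m h) (𝟙 Y) (trans_sq f n m h))) =
      incl f (n + 1) (stageFill f n b) := by
  induction m, h using Nat.le_induction with
  | base =>
    congr 2
    refine OpenBox.ext' rfl rfl rfl (fun _ _ _ _ => ?_)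
    change trans f n n le_rfl _ = _
    rw [trans_self]; rfl
  | succ m hm ih =>
    rw [← ih, ← incl_j f (m + 1)]
    congr 1
    refine congrArg (Pre.fill ε) (OpenBox.ext' rfl rfl rfl (fun c i _ _ => ?_))
    change trans f n (m + 1) _ _ = _
    rw [trans_succ f n m hm]; rfl

theorem exists_boxIncl (f : X ⟶ Y) {ε : Bool} (b : OpenBox (rho f) ε) :
    ∃ n, ∃ b' : OpenBox (stage f n).r ε, boxIncl f n b' = b := by
  choose N y hy using fun x : K f => incl_surj f x
  let n : ℕ := (b.A ×ˢ Finset.univ).sup fun p =>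
    if h : Face b.A b.a ε p.1 p.2 then N (b.u p.1 p.2 h) else 0
  have hn : ∀ c i (h : Face b.A b.a ε c i), N (b.u c i h) ≤ n := by
    intro c i h
    have := Finset.le_sup (f := fun p : 𝔸 × Bool =>
      if h : Face b.A b.a ε p.1 p.2 then N (b.u p.1 p.2 h) else 0)
      (Finset.mem_product.2 ⟨h.1, Finset.mem_univ i⟩ : (c, i) ∈ b.A ×ˢ Finset.univ)
    dsimp only at this
    rwa [dif_pos h] at this
  let z : ∀ c i, Face b.A b.a ε c i → (stage f n).P := fun c i h =>
    trans f _ n (hn c i h) (y (b.u c i h))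
  have hz : ∀ c i h, incl f n (z c i h) = b.u c i h := fun c i h => by
    rw [incl_trans, ← hy]
  refine ⟨n, ⟨b.A, b.a, b.a_mem, z, b.y, ?_, ?_, ?_⟩, OpenBox.ext' rfl rfl rfl fun c i h _ => hz c i h⟩
  · intro c i h
    have h1 := b.fresh c i h
    rw [← hz] at h1
    obtain ⟨T, hcT, hT⟩ := fresh_iff.1 h1
    exact fresh_iff.2 ⟨T, hcT, fun π hπ => incl_injective f n (by rw [map_smul]; exact hT π hπ)⟩
  · intro c i h c' i' h' hne
    apply incl_injective f n
    rw [map_sub, map_sub, hz, hz, b.adj _ _ _ _ _ _ hne]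
  · intro c i h
    rw [← b.proj c i h, ← hz, incl_rho]

/-- An open box `(u, y)` in `K f`, as an element of `K f`. -/
def boxK (f : X ⟶ Y) {ε : Bool} (b : OpenBox (rho f) ε) : K f :=
  incl f ((exists_boxIncl f b).choose + 1) (stageFill f _ (exists_boxIncl f b).choose_spec.choose)

theorem boxK_boxIncl (f : X ⟶ Y) {ε : Bool} (n : ℕ) (b : OpenBox (stage f n).r ε) :
    boxK f (boxIncl f n b) = incl f (n + 1) (stageFill f n b) := by
  have h := (exists_boxIncl f (boxIncl f n b)).choose_spec.choose_spec
  rw [boxK]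
  generalize (exists_boxIncl f (boxIncl f n b)).choose_spec.choose = b' at h ⊢
  generalize (exists_boxIncl f (boxIncl f n b)).choose = m at b' h ⊢
  rw [← incl_stageFill_trans f m (max m n) (le_max_left m n),
    ← incl_stageFill_trans f n (max m n) (le_max_right m n)]
  congr 2
  apply boxIncl_injective
  rw [boxIncl_trans, boxIncl_trans, h]

theorem incl_pt (f : X ⟶ Y) (n : ℕ) (x : X) :
    incl f (n + 1) (Pre.pt x : Pre f (stage f n).r) = lam f x := by
  induction n with
  | zero => exact incl_j f 0 x
  | succ n ih => exact (incl_j f (n + 1) (Pre.pt x : Pre f (stage f n).r)).trans ih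

/-- The open boxes in `K f` are fillers of themselves. -/
def fillK (f : X ⟶ Y) (ε : Bool) : KanFilling (rho f) ε where
  fill := boxK f
  fill_side b c i h := by
    obtain ⟨n, b, rfl⟩ := exists_boxIncl f b
    rw [boxK_boxIncl, ← map_sub]
    refine Eq.trans ?_ (incl_j f n (b.u c i h))
    exact congrArg (incl f (n + 1)) (Pre.subBox_face b c i h)
  fill_proj b := by
    obtain ⟨n, b, rfl⟩ := exists_boxIncl f b
    rw [boxK_boxIncl]; rfl
  fill_smul π b := by
    obtain ⟨n, b, rfl⟩ := exists_boxIncl f b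
    have : π • boxIncl f n b = boxIncl f n (π • b) := (OpenBox.map_smul _ _ _ _ π).symm
    rw [this, boxK_boxIncl, boxK_boxIncl]; rfl
  fill_sub b c i hc := by
    obtain ⟨n, b, rfl⟩ := exists_boxIncl f b
    have : (boxIncl f n b).sub c i hc = boxIncl f n (b.sub c i hc) :=
      (OpenBox.map_sub b _ _ _ c i hc).symm
    rw [this, boxK_boxIncl, boxK_boxIncl, ← map_sub]
    exact congrArg (incl f (n + 1)) (Pre.subBox_notMem b c i hc).symm

end stages

/-! ### Recursion on the stages -/

section lift

variable {X Y Z V : Sub01 𝔸} {f : X ⟶ Y} {g : Z ⟶ V}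
  (Φ : ∀ ε, KanFilling g ε) (h : X ⟶ Z) (k : Y ⟶ V)

/-- The recursion step: `x ↦ h(x)`, an open box `(u, y)` goes to the filler of the box
`(φ ∘ u, k(y))`, and `⟨a⟩(u, y)` to the substitution `(a := ε)` in that filler. -/
def preLift (s : Stage f) (φ : s.P ⟶ Z) (hφ : ∀ p, g (φ p) = k (s.r p)) : Pre f s.r → Z
  | .pt x => h x
  | .fill ε b => (Φ ε).fill (b.map φ k hφ)
  | .comp ε q => q.lift (fun b => sub ((Φ ε).fill (b.map φ k hφ)) b.a ε) (fun b d hd => by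
      have h1 : sub ((Φ ε).fill ((transp d b.a • b).map φ k hφ)) (transp d b.a • b).a ε =
          transp d b.a • sub ((Φ ε).fill (b.map φ k hφ)) b.a ε := by
        rw [OpenBox.map_smul, (Φ ε).fill_smul, ZeroOneSet.smul_sub, OpenBox.smul_a]
      rw [h1]
      refine transp_fresh (Fresh.sub_any ?_ _ _) (ZeroOneSet.fresh_sub _ _ _)
      exact hd.map (F := fun b => (Φ ε).fill (b.map φ k hφ))
        (fun π b => by rw [OpenBox.map_smul, (Φ ε).fill_smul]))

/-- A map out of a stage that is compatible with the recursion step. -/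
structure StageLift (s : Stage f) where
  φ : s.P ⟶ Z
  sq : ∀ p, g (φ p) = k (s.r p)
  compat : ∀ p, preLift Φ h k s φ sq (s.j p) = φ p

variable {Φ h k} (hk : ∀ x, g (h x) = k (f x))

/-- The recursion step as a morphism. -/
def StageLift.hom {s : Stage f} (l : StageLift Φ h k s) : s.nextP ⟶ Z where
  toFun := preLift Φ h k s l.φ l.sq
  map_smul' π p := by
    cases p with
    | pt x => exact map_smul h π x
    | fill ε b =>
      change (Φ ε).fill ((π • b).map _ _ _) = π • (Φ ε).fill (b.map _ _ _)
      rw [OpenBox.map_smul, (Φ ε).fill_smul]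
    | comp ε q =>
      induction q using Comp.ind with | h b =>
      change sub ((Φ ε).fill ((π • b).map _ _ _)) (π • b.a) ε =
        π • sub ((Φ ε).fill (b.map _ _ _)) b.a ε
      rw [OpenBox.map_smul, (Φ ε).fill_smul, ZeroOneSet.smul_sub]
  map_sub' p c i := by
    change preLift Φ h k s l.φ l.sq (Pre.sub s.j s.j_smul p c i) = _
    cases p with
    | pt x => exact map_sub h x c i
    | fill ε b =>
      rw [Stage.sub_fill]
      rcases Pre.box_cases b c i with h1 | ⟨rfl, rfl⟩ | h1
      · rw [Pre.subBox_face _ _ _ h1, l.compat]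
        exact ((Φ ε).fill_side (b.map l.φ k l.sq) c i h1).symm
      · rw [Pre.subBox_end]; rfl
      · rw [Pre.subBox_notMem _ _ _ h1]
        change (Φ ε).fill ((b.sub c i h1).map l.φ k l.sq) = _
        rw [OpenBox.map_sub]
        exact (Φ ε).fill_sub (b.map l.φ k l.sq) c i h1
    | comp ε q =>
      obtain ⟨b, rfl, hb⟩ := Comp.exists_rep {c} q
      replace hb : c ≠ b.a := fun e => hb (by simp [e])
      rw [Stage.sub_comp_mk]
      change _ = sub (sub ((Φ ε).fill (b.map l.φ k l.sq)) b.a ε) c i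
      rw [ZeroOneSet.sub_comm _ _ _ _ _ hb.symm]
      by_cases h1 : c ∈ b.A
      · rw [Pre.subCompBox_mem _ _ _ h1 hb, l.compat, map_sub]
        exact congrArg (fun z => sub z b.a ε)
          ((Φ ε).fill_side (b.map l.φ k l.sq) c i (Pre.face_of_ne h1 hb i)).symm
      · rw [Pre.subCompBox_notMem _ _ _ h1]
        change sub ((Φ ε).fill ((b.sub c i h1).map l.φ k l.sq)) b.a ε = _
        rw [OpenBox.map_sub]
        exact congrArg (fun z => sub z b.a ε) ((Φ ε).fill_sub (b.map l.φ k l.sq) c i h1)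

theorem StageLift.hom_j {s : Stage f} (l : StageLift Φ h k s) (p : s.P) :
    l.hom (s.jHom p) = l.φ p := l.compat p

theorem StageLift.hom_sq (hk : ∀ x, g (h x) = k (f x)) {s : Stage f} (l : StageLift Φ h k s)
    (p : s.nextP) : g (l.hom p) = k (s.nextR p) := by
  change g (preLift Φ h k s l.φ l.sq p) = k (Pre.rho p)
  cases p with
  | pt x => exact hk x
  | fill ε b => exact (Φ ε).fill_proj _
  | comp ε q =>
    induction q using Comp.ind with | h b =>
    change g (sub ((Φ ε).fill (b.map l.φ k l.sq)) b.a ε) = k (sub b.y b.a ε)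
    rw [map_sub, (Φ ε).fill_proj, map_sub]; rfl

/-- The recursion step for stages. -/
def StageLift.next (hk : ∀ x, g (h x) = k (f x)) {s : Stage f} (l : StageLift Φ h k s) :
    StageLift Φ h k s.next where
  φ := l.hom
  sq := l.hom_sq hk
  compat p := by
    have key : ∀ {ε : Bool} (b : OpenBox s.r ε),
        (b.map s.jHom (𝟙 Y) s.j_sq).map l.hom k (l.hom_sq hk) = b.map l.φ k l.sq := fun b =>
      OpenBox.ext' rfl rfl rfl (fun c i h1 _ => l.hom_j (b.u c i h1))
    cases p with
    | pt x => rfl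
    | fill ε b => exact congrArg (Φ ε).fill (key b)
    | comp ε q =>
      induction q using Comp.ind with | h b =>
      exact congrArg (fun b' => sub ((Φ ε).fill b') b.a ε) (key b)

variable (Φ h k)

/-- The maps `K_n f ⟶ Z` defined by recursion on `n`. -/
def stageLift (hk : ∀ x, g (h x) = k (f x)) : (n : ℕ) → StageLift Φ h k (stage f n)
  | 0 =>
    { φ := h
      sq := hk
      compat := fun _ => rfl }
  | n + 1 => (stageLift hk n).next hk

theorem stageLift_trans (hk : ∀ x, g (h x) = k (f x)) (n m : ℕ) (hnm : n ≤ m)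
    (x : (stage f n).P) :
    (stageLift Φ h k hk m).φ (trans f n m hnm x) = (stageLift Φ h k hk n).φ x := by
  induction m, hnm using Nat.le_induction with
  | base => rw [trans_self]; rfl
  | succ m hm ih =>
    rw [trans_succ f n m hm, ← ih]
    exact (stageLift Φ h k hk m).hom_j _

/-- The map `K f ⟶ Z` over `k : Y ⟶ V` that extends `h : X ⟶ Z`, sends open boxes in `K f` to
chosen fillers, and is defined by recursion on the stages. -/
def liftK (hk : ∀ x, g (h x) = k (f x)) : K f ⟶ Z where
  toFun := DirectLimit.lift _ (fun n x => (stageLift Φ h k hk n).φ x)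
    (fun n m hnm x => (stageLift_trans Φ h k hk n m hnm x).symm)
  map_smul' π x := by
    induction x using DirectLimit.induction with | ih n x =>
    exact map_smul (stageLift Φ h k hk n).φ π x
  map_sub' x c i := by
    induction x using DirectLimit.induction with | ih n x =>
    exact map_sub (stageLift Φ h k hk n).φ x c i

variable (hk : ∀ x, g (h x) = k (f x))

theorem liftK_incl (n : ℕ) (x : (stage f n).P) :
    liftK Φ h k hk (incl f n x) = (stageLift Φ h k hk n).φ x := rfl

theorem liftK_lam (x : X) : liftK Φ h k hk (lam f x) = h x := rfl

theorem liftK_sq (x : K f) : g (liftK Φ h k hk x) = k (rho f x) := by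
  obtain ⟨n, x, rfl⟩ := incl_surj f x
  rw [liftK_incl, incl_rho, StageLift.sq]

theorem liftK_box {ε : Bool} (b : OpenBox (rho f) ε) :
    liftK Φ h k hk (boxK f b) = (Φ ε).fill (b.map (liftK Φ h k hk) k (liftK_sq Φ h k hk)) := by
  obtain ⟨n, b, rfl⟩ := exists_boxIncl f b
  rw [boxK_boxIncl, liftK_incl]
  rfl

variable {k}

/-- Two maps out of `K f` that agree on `X` and on open boxes are equal. -/
theorem K_ext {φ ψ : K f ⟶ Z} (hφ : ∀ x, g (φ x) = k (rho f x))
    (hψ : ∀ x, g (ψ x) = k (rho f x)) (h0 : ∀ x, φ (lam f x) = ψ (lam f x))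
    (h1 : ∀ ε (b : OpenBox (rho f) ε), φ (boxK f b) = (Φ ε).fill (b.map φ k hφ))
    (h2 : ∀ ε (b : OpenBox (rho f) ε), ψ (boxK f b) = (Φ ε).fill (b.map ψ k hψ)) : φ = ψ := by
  apply hom_ext
  intro x
  obtain ⟨n, x, rfl⟩ := incl_surj f x
  induction n with
  | zero => exact h0 x
  | succ n ih =>
    have key : ∀ {ε : Bool} (b : OpenBox (stage f n).r ε),
        φ (incl f (n + 1) (stageFill f n b)) = ψ (incl f (n + 1) (stageFill f n b)) := by
      intro ε b
      rw [← boxK_boxIncl, h1, h2]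
      exact congrArg (Φ ε).fill (OpenBox.ext' rfl rfl rfl (fun c i _ _ => ih _))
    have hx : ∀ y : (stage f (n + 1)).P, y = x → φ (incl f (n + 1) y) = ψ (incl f (n + 1) y) := by
      intro y hy
      change Pre f (stage f n).r at x
      cases x with
      | pt x =>
        subst hy
        have h3 := incl_pt f n x
        exact ((congrArg φ h3).trans (h0 x)).trans (congrArg ψ h3).symm
      | fill ε b => subst hy; exact key b
      | comp ε q =>
        induction q using Comp.ind with | h b =>
        have h3 : y = sub (stageFill f n b) b.a ε := hy.trans (Pre.subBox_end b).symm
        rw [h3, map_sub, map_sub, map_sub, key]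
    exact hx x rfl

end lift

/-! ### The monad `R` -/

section monad

variable {X Y U V S T : Sub01 𝔸}

/-- The functorial action of `K`: the map `K(h, k) : K f ⟶ K g` of a commutative square
`(h, k) : f ⟶ g`, which is `h` on `X`, sends a box `(u, y)` to `(K(h, k) ∘ u, k(y))`, and
`⟨a⟩(u, y)` to `⟨a⟩(K(h, k) ∘ u, k(y))`. -/
def mapK {f : X ⟶ Y} {g : U ⟶ V} (h : X ⟶ U) (k : Y ⟶ V) (sq : ∀ x, g (h x) = k (f x)) :
    K f ⟶ K g :=
  liftK (fillK g) (h ≫ lam g) k sq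

theorem mapK_lam {f : X ⟶ Y} {g : U ⟶ V} (h : X ⟶ U) (k : Y ⟶ V)
    (sq : ∀ x, g (h x) = k (f x)) (x : X) : mapK h k sq (lam f x) = lam g (h x) := rfl

theorem mapK_sq {f : X ⟶ Y} {g : U ⟶ V} (h : X ⟶ U) (k : Y ⟶ V)
    (sq : ∀ x, g (h x) = k (f x)) (x : K f) : rho g (mapK h k sq x) = k (rho f x) :=
  liftK_sq (fillK g) (h ≫ lam g) k sq x

theorem mapK_box {f : X ⟶ Y} {g : U ⟶ V} (h : X ⟶ U) (k : Y ⟶ V)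
    (sq : ∀ x, g (h x) = k (f x)) {ε : Bool} (b : OpenBox (rho f) ε) :
    mapK h k sq (boxK f b) = boxK g (b.map (mapK h k sq) k (mapK_sq h k sq)) :=
  liftK_box (fillK g) (h ≫ lam g) k sq b

/-- The map `π_f : K ρ_f ⟶ K f`, which is the identity on `K f` and sends a box `(u, y)` to
`(π_f ∘ u, y)`. -/
def mulK (f : X ⟶ Y) : K (rho f) ⟶ K f :=
  liftK (fillK f) (𝟙 (K f)) (𝟙 Y) (fun _ => rfl)

theorem mulK_lam (f : X ⟶ Y) (x : K f) : mulK f (lam (rho f) x) = x := rfl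

theorem mulK_sq (f : X ⟶ Y) (x : K (rho f)) : rho f (mulK f x) = (𝟙 Y : Y ⟶ Y) (rho (rho f) x) :=
  liftK_sq (fillK f) (𝟙 (K f)) (𝟙 Y) (fun _ => rfl) x

theorem mulK_box (f : X ⟶ Y) {ε : Bool} (b : OpenBox (rho (rho f)) ε) :
    mulK f (boxK (rho f) b) = boxK f (b.map (mulK f) (𝟙 Y) (mulK_sq f)) :=
  liftK_box (fillK f) (𝟙 (K f)) (𝟙 Y) (fun _ => rfl) b

theorem mapK_id (f : X ⟶ Y) : mapK (f := f) (g := f) (𝟙 X) (𝟙 Y) (fun _ => rfl) = 𝟙 (K f) :=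
  K_ext (fillK f) (k := 𝟙 Y) (mapK_sq _ _ _) (fun _ => rfl) (fun _ => rfl)
    (fun _ b => mapK_box _ _ _ b) (fun _ _ => rfl)

theorem mapK_comp {f : X ⟶ Y} {g : U ⟶ V} {e : S ⟶ T} (h : X ⟶ U) (k : Y ⟶ V)
    (sq : ∀ x, g (h x) = k (f x)) (h' : U ⟶ S) (k' : V ⟶ T) (sq' : ∀ x, e (h' x) = k' (g x))
    (sq'' : ∀ x, e ((h ≫ h') x) = (k ≫ k') (f x)) :
    mapK (h ≫ h') (k ≫ k') sq'' = mapK h k sq ≫ mapK h' k' sq' :=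
  K_ext (fillK e) (k := k ≫ k') (mapK_sq _ _ _)
    (fun x => (mapK_sq h' k' sq' _).trans (congrArg k' (mapK_sq h k sq x)))
    (fun _ => rfl) (fun _ b => mapK_box _ _ _ b)
    (fun _ b => by
      rw [comp_apply, mapK_box, mapK_box]; rfl)

theorem mulK_naturality {f : X ⟶ Y} {g : U ⟶ V} (h : X ⟶ U) (k : Y ⟶ V)
    (sq : ∀ x, g (h x) = k (f x)) :
    mapK (mapK h k sq) k (mapK_sq h k sq) ≫ mulK g = mulK f ≫ mapK h k sq :=
  K_ext (fillK g) (k := k)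
    (fun x => (mulK_sq g _).trans (mapK_sq (mapK h k sq) k _ x))
    (fun x => (mapK_sq h k sq _).trans (congrArg k (mulK_sq f x)))
    (fun _ => rfl)
    (fun _ b => by rw [comp_apply, mapK_box, mulK_box]; rfl)
    (fun _ b => by rw [comp_apply, mulK_box, mapK_box]; rfl)

theorem lam_sq (f : X ⟶ Y) (x : X) : rho f (lam f x) = (𝟙 Y : Y ⟶ Y) (f x) := rfl

theorem mapK_lam_mulK (f : X ⟶ Y) :
    mapK (lam f) (𝟙 Y) (lam_sq f) ≫ mulK f = 𝟙 (K f) :=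
  K_ext (fillK f) (k := 𝟙 Y)
    (fun x => (mulK_sq f _).trans (mapK_sq _ _ _ x)) (fun _ => rfl) (fun _ => rfl)
    (fun _ b => by rw [comp_apply, mapK_box, mulK_box]; rfl) (fun _ _ => rfl)

theorem mulK_assoc (f : X ⟶ Y) :
    mapK (mulK f) (𝟙 Y) (mulK_sq f) ≫ mulK f = mulK (rho f) ≫ mulK f :=
  K_ext (fillK f) (k := 𝟙 Y)
    (fun x => (mulK_sq f _).trans (mapK_sq _ _ _ x))
    (fun x => (mulK_sq f _).trans (mulK_sq (rho f) x))
    (fun _ => rfl)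
    (fun _ b => by rw [comp_apply, mapK_box, mulK_box]; rfl)
    (fun _ b => by rw [comp_apply, mulK_box, mulK_box]; rfl)

theorem sq_of_arrow {f g : Arrow (Sub01 𝔸)} (α : f ⟶ g) (x : f.left) :
    g.hom (α.left x) = α.right (f.hom x) :=
  DFunLike.congr_fun α.w x

variable (𝔸) in
/-- The monad `R` on the arrow category: it sends `f` to `ρ_f`, its unit at `f` is the square
`(λ_f, 1) : f ⟶ ρ_f`, and its multiplication is the square `(π_f, 1) : ρ_(ρ_f) ⟶ ρ_f`. -/
def R : Monad (Arrow (Sub01 𝔸)) where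
  obj f := Arrow.mk (rho f.hom)
  map α := Arrow.homMk (mapK α.left α.right (sq_of_arrow α)) α.right
    (hom_ext fun x => mapK_sq α.left α.right (sq_of_arrow α) x)
  map_id f := Arrow.hom_ext _ _ (mapK_id f.hom) rfl
  map_comp α β := Arrow.hom_ext _ _
    (mapK_comp α.left α.right (sq_of_arrow α) β.left β.right (sq_of_arrow β) _) rfl
  η :=
    { app := fun f => Arrow.homMk (lam f.hom) (𝟙 _) rfl
      naturality := fun _ _ _ => Arrow.hom_ext _ _ rfl rfl }
  μ :=
    { app := fun f => Arrow.homMk (mulK f.hom) (𝟙 _) (hom_ext fun x => mulK_sq f.hom x)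
      naturality := fun _ _ α => Arrow.hom_ext _ _
        (mulK_naturality α.left α.right (sq_of_arrow α)) rfl }
  assoc f := Arrow.hom_ext _ _ (mulK_assoc f.hom) rfl
  left_unit _ := Arrow.hom_ext _ _ rfl rfl
  right_unit f := Arrow.hom_ext _ _ (mapK_lam_mulK f.hom) rfl

/-- A structure of algebra on `f` for `R` as a pointed endofunctor: only the unit law is
required. -/
structure PointedAlg {X Y : Sub01 𝔸} (f : X ⟶ Y) where
  a : (R 𝔸).obj (Arrow.mk f) ⟶ Arrow.mk f
  unit : (R 𝔸).η.app (Arrow.mk f) ≫ a = 𝟙 (Arrow.mk f)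

/-- A (monad) `R`-algebra structure on `f`: the multiplication law is required as well. -/
structure MonadAlg {X Y : Sub01 𝔸} (f : X ⟶ Y) extends PointedAlg f where
  assoc : (R 𝔸).μ.app (Arrow.mk f) ≫ a = (R 𝔸).map a ≫ a

variable (𝔸) in
/-- The class of `R`-maps: the maps that admit a (monad) `R`-algebra structure. -/
def RMap : MorphismProperty (Sub01 𝔸) := fun _ _ f => Nonempty (MonadAlg f)

variable (𝔸) in
/-- The class `R̄`: the retract closure of the `R`-maps. -/
def RBar : MorphismProperty (Sub01 𝔸) := (RMap 𝔸).retracts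

end monad

end

end ZeroOne

/-!
The 01-substitution set `K f` is freely generated by `X` under fillers of open boxes over `Y`:
a map out of `K f` over a base map is determined by its restriction to `X` and by the requirement
that it send the open boxes in `K f` to chosen fillers (`liftK`, `K_ext`). The implications are
proved in the cycle `1 → 2 → 3 → 4 → 1`.

* A retract of a pointed-endofunctor algebra is again one, by naturality of the unit
  (`PointedAlg.ofRetract`). This uses no multiplication law, so it applies to retracts of maps that
  carry a monad algebra structure.
* If `α : K f ⟶ X` is the top component of a pointed-endofunctor algebra structure, then an open
  box in `X` can be moved along `λ_f` to `K f`, where it is its own filler, and this filler can be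
  moved back along `α`. Since `α` retracts `λ_f` over `Y`, the result is a filler of the box; the
  uniformity conditions hold because `α` and `λ_f` are morphisms (`PointedAlg.kanFilling`).
* Kan filling operators on `f` extend the identity of `X` to `K f ⟶ X`. In the multiplication law,
  both composites `K ρ_f ⟶ X` restrict to this extension on `K f` and send open boxes to chosen
  fillers, so they are equal (`MonadAlg.ofKanFilling`).
* Every map is a retract of itself.
-/

namespace ZeroOne

noncomputable section

variable {𝔸 : Type u} [Infinite 𝔸] {X Y U V : Sub01 𝔸}

/-- Pointed-endofunctor algebra structures pass to retracts. -/
def PointedAlg.ofRetract {f : X ⟶ Y} {g : U ⟶ V} (e : RetractArrow f g) (s : PointedAlg g) :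
    PointedAlg f where
  a := (R 𝔸).map e.i ≫ s.a ≫ e.r
  unit := by
    have h := (R 𝔸).η.naturality e.i
    simp only [Functor.id_map] at h
    rw [← Category.assoc, ← h, Category.assoc, ← Category.assoc ((R 𝔸).η.app _), s.unit]
    exact (congrArg (e.i ≫ ·) (Category.id_comp e.r)).trans e.retract

namespace PointedAlg

variable {f : X ⟶ Y} (s : PointedAlg f)

/-- The top component `K f ⟶ X` of an algebra structure. -/
def top : K f ⟶ X := s.a.left

theorem top_lam (x : X) : s.top (lam f x) = x :=
  DFunLike.congr_fun (congrArg CommaMorphism.left s.unit) x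

/-- The unit law forces the bottom component of an algebra structure to be the identity. -/
theorem top_sq (x : K f) : f (s.top x) = rho f x :=
  (sq_of_arrow s.a x).trans
    (DFunLike.congr_fun (congrArg CommaMorphism.right s.unit) (rho f x))

/-- The filler of an open box in `X` is the image under `K f ⟶ X` of the box itself, seen as an
element of `K f`. -/
def kanFilling (ε : Bool) : KanFilling f ε where
  fill b := s.top (boxK f (b.map (lam f) (𝟙 Y) (lam_sq f)))
  fill_side b c i h := by
    rw [← map_sub]
    exact (congrArg s.top ((fillK f ε).fill_side (b.map (lam f) (𝟙 Y) (lam_sq f)) c i h)).trans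
      (s.top_lam _)
  fill_proj b := (s.top_sq _).trans ((fillK f ε).fill_proj _)
  fill_smul π b := by
    rw [OpenBox.map_smul, ← map_smul]
    exact congrArg s.top ((fillK f ε).fill_smul π _)
  fill_sub b c i hc := by
    rw [OpenBox.map_sub, ← map_sub]
    exact congrArg s.top ((fillK f ε).fill_sub (b.map (lam f) (𝟙 Y) (lam_sq f)) c i hc)

end PointedAlg

section ofKanFilling

variable {f : X ⟶ Y} (Φ : ∀ ε, KanFilling f ε)

/-- The map `K f ⟶ X` that is the identity on `X` and sends open boxes to their fillers. -/
def evalK : K f ⟶ X := liftK Φ (𝟙 X) (𝟙 Y) (fun _ => rfl)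

theorem evalK_sq (x : K f) : f (evalK Φ x) = (𝟙 Y : Y ⟶ Y) (rho f x) :=
  liftK_sq Φ (𝟙 X) (𝟙 Y) (fun _ => rfl) x

theorem evalK_box {ε : Bool} (b : OpenBox (rho f) ε) :
    evalK Φ (boxK f b) = (Φ ε).fill (b.map (evalK Φ) (𝟙 Y) (evalK_sq Φ)) :=
  liftK_box Φ (𝟙 X) (𝟙 Y) (fun _ => rfl) b

theorem mulK_evalK : mulK f ≫ evalK Φ = mapK (evalK Φ) (𝟙 Y) (evalK_sq Φ) ≫ evalK Φ :=
  K_ext Φ (k := 𝟙 Y)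
    (fun x => (evalK_sq Φ _).trans (mulK_sq f x))
    (fun x => (evalK_sq Φ _).trans (mapK_sq (evalK Φ) (𝟙 Y) (evalK_sq Φ) x))
    (fun _ => rfl)
    (fun _ b => by rw [comp_apply, mulK_box, evalK_box]; rfl)
    (fun _ b => by rw [comp_apply, mapK_box, evalK_box]; rfl)

/-- The monad algebra structure that is given by Kan filling operators. -/
def MonadAlg.ofKanFilling : MonadAlg f where
  a := Arrow.homMk (evalK Φ) (𝟙 Y) (hom_ext fun x => evalK_sq Φ x)
  unit := Arrow.hom_ext _ _ rfl rfl
  assoc := Arrow.hom_ext _ _ (mulK_evalK Φ) rfl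

end ofKanFilling

end

end ZeroOne

/-- For a morphism `f` of 01-substitution sets over an infinite set `𝔸` of names, the following are
equivalent: `f` is a retract of a map with an `R`-algebra structure; `f` has an algebra structure
for `R` as a pointed endofunctor; `f` is a Kan fibration; `f` has an algebra structure for the
monad `R`. -/
theorem mainTheorem2 {𝔸 : Type u} [Infinite 𝔸] {X Y : ZeroOne.Sub01 𝔸} (f : X ⟶ Y) :
    List.TFAE
      [ZeroOne.RBar 𝔸 f,
       Nonempty (ZeroOne.PointedAlg f),
       ZeroOne.IsKanFibration f,
       Nonempty (ZeroOne.MonadAlg f)] := by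
  tfae_have 1 → 2 := by
    rintro ⟨_, _, _, e, ⟨s⟩⟩
    exact ⟨.ofRetract e s.toPointedAlg⟩
  tfae_have 2 → 3 := fun ⟨s⟩ => ⟨⟨s.kanFilling true⟩, ⟨s.kanFilling false⟩⟩
  tfae_have 3 → 4 := fun ⟨⟨Φ₁⟩, ⟨Φ₀⟩⟩ => ⟨.ofKanFilling (Bool.rec Φ₀ Φ₁)⟩
  tfae_have 4 → 1 := fun h => (ZeroOne.RMap 𝔸).le_retracts f h
  tfae_finish
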